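/- Let $p,q:\mathbb{R}\to\mathbb{C}$ be $\pi$-periodic functions that are of bounded variation on $[0,\pi]$, and put $Q(x)=\begin{pmatrix}p(x)&q(x)\\q(x)&-p(x)\end{pmatrix}$. For $t\in\mathbb{C}$ let $L_t(Q)$ be the operator in $L_2([0,\pi];\mathbb{C}^2)$ generated by the differential expression $$l(\mathbf{y},Q)=\begin{pmatrix}0&1\\-1&0\end{pmatrix}\mathbf{y}'+Q\mathbf{y}$$ and the boundary condition $\mathbf{y}(\pi)=e^{i\pi t}\mathbf{y}(0)$; its domain consists of the absolutely continuous $\mathbf{y}$ on $[0,\pi]$ that satisfy the boundary condition and have $l(\mathbf{y},Q)\in L_2([0,\pi];\mathbb{C}^2)$. Let $h\in(0,1/10)$ and $$D_h(0,1)=\{t\in\mathbb{C}:|\operatorname{Im}t|\le 2h,\ -h\le\operatorname{Re}t\le 2-h\}\setminus\bigl(\{|t|<h\}\cup\{|t-1|<h\}\bigr).$$ Then for every $t\in D_h(0,1)$ the eigenvalues of $L_t(Q)$, counted with algebraic multiplicity (the dimension of the space of eigenfunctions and associated functions), consist of two sequences $\{\lambda_{n,1}(t):n\in\mathbb{Z}\}$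 and $\{\lambda_{n,2}(t):n\in\mathbb{Z}\}$ that satisfy, as $|n|\to\infty$, $$\lambda_{n,1}(t)=2n+t+O\!\left(\tfrac1n\right),\qquad \lambda_{n,2}(t)=2n-t+O\!\left(\tfrac1n\right),$$ uniformly in $t\in D_h(0,1)$: there are constants $M$ and $N$, depending only on $p$, $q$ and $h$, such that $|\lambda_{n,1}(t)-(2n+t)|\le M/|n|$ and $|\lambda_{n,2}(t)-(2n-t)|\le M/|n|$ for all $t\in D_h(0,1)$ and all $n\in\mathbb{Z}$ with $|n|>N$. -/

import Mathlib

open MeasureTheory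

noncomputable section

namespace Dirac

/-- Lebesgue measure on `[0, π]`. -/
abbrev mu : Measure ℝ := volume.restrict (Set.Icc 0 Real.pi)

/-- The Hilbert space `L₂²[0, π]` of square integrable functions with values in `ℂ²`. -/
abbrev L2 : Type := Lp (EuclideanSpace ℂ (Fin 2)) 2 mu

/-- The matrix potential `Q = (p, q; q, -p)`. -/
def potential (p q : ℝ → ℂ) (x : ℝ) : Matrix (Fin 2) (Fin 2) ℂ :=
  !![p x, q x; q x, -p x]

/-- The differential expression `l(y, Q) = (0, 1; -1, 0) y' + Q y`. -/
def diffExpr (p q : ℝ → ℂ) (y : ℝ → Fin 2 → ℂ) (x : ℝ) : Fin 2 → ℂ :=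
  Matrix.mulVec !![0, 1; -1, 0] (deriv y x) + Matrix.mulVec (potential p q x) (y x)

/-- `y` is an absolutely continuous function on `[0, π]` with `y(π) = e^{iπt} y(0)`. -/
def IsAdmissible (t : ℂ) (y : ℝ → Fin 2 → ℂ) : Prop :=
  AbsolutelyContinuousOnInterval y 0 Real.pi ∧
    y Real.pi = Complex.exp (Complex.I * Real.pi * t) • y 0

theorem ae_differentiableAt {y : ℝ → Fin 2 → ℂ}
    (hy : AbsolutelyContinuousOnInterval y 0 Real.pi) :
    ∀ᵐ x ∂mu, DifferentiableAt ℝ y x := by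
  have h1 := hy.boundedVariationOn
  rw [Set.uIcc_of_le Real.pi_pos.le] at h1
  have h2 := h1.locallyBoundedVariationOn.ae_differentiableWithinAt measurableSet_Icc
  have h3 : ∀ᵐ x ∂mu, x ∈ Set.Ioo 0 Real.pi := by
    have h : mu = volume.restrict (Set.Ioo 0 Real.pi) :=
      (Measure.restrict_congr_set Ioo_ae_eq_Icc).symm
    rw [h]
    exact ae_restrict_mem measurableSet_Ioo
  filter_upwards [h2, h3] with x hx hx'
  exact hx.differentiableAt (Icc_mem_nhds hx'.1 hx'.2)

/-- The graph of `L_t(Q)`: the pairs `(f, g)` in `L₂²[0, π]` such that `f` has an absolutely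
continuous representative `y` with `y(π) = e^{iπt} y(0)` and `g = l(y, Q)` almost everywhere. -/
def graph (p q : ℝ → ℂ) (t : ℂ) : Submodule ℂ (L2 × L2) where
  carrier := {fg | ∃ y : ℝ → Fin 2 → ℂ, IsAdmissible t y ∧
    (∀ᵐ x ∂mu, (fg.1 x).ofLp = y x) ∧ (∀ᵐ x ∂mu, (fg.2 x).ofLp = diffExpr p q y x)}
  zero_mem' := by
    refine ⟨fun _ => 0, ⟨?_, by simp⟩, ?_, ?_⟩
    · exact (LipschitzWith.const (0 : Fin 2 → ℂ)).lipschitzOnWith.absolutelyContinuousOnInterval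
    · filter_upwards [Lp.coeFn_zero (EuclideanSpace ℂ (Fin 2)) 2 mu] with x hx
      exact congrArg WithLp.ofLp hx
    · filter_upwards [Lp.coeFn_zero (EuclideanSpace ℂ (Fin 2)) 2 mu] with x hx
      exact (congrArg WithLp.ofLp hx).trans (by simp [diffExpr])
  add_mem' := by
    rintro a b ⟨y, ⟨hy, hyb⟩, hy1, hy2⟩ ⟨z, ⟨hz, hzb⟩, hz1, hz2⟩
    refine ⟨y + z, ⟨hy.add hz, by simp [hyb, hzb]⟩, ?_, ?_⟩
    · filter_upwards [hy1, hz1, Lp.coeFn_add a.1 b.1] with x h1 h2 h3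
      rw [Prod.fst_add, h3, Pi.add_apply, WithLp.ofLp_add, h1, h2, Pi.add_apply]
    · filter_upwards [hy2, hz2, Lp.coeFn_add a.2 b.2, ae_differentiableAt hy,
        ae_differentiableAt hz] with x h1 h2 h3 h4 h5
      simp only [Prod.snd_add, h3, Pi.add_apply, WithLp.ofLp_add, h1, h2, diffExpr,
        deriv_add h4 h5, Matrix.mulVec_add]
      abel
  smul_mem' := by
    rintro c a ⟨y, ⟨hy, hyb⟩, hy1, hy2⟩
    refine ⟨c • y, ⟨hy.const_smul c, by simp [hyb, smul_comm c]⟩, ?_, ?_⟩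
    · filter_upwards [hy1, Lp.coeFn_smul c a.1] with x h1 h3
      rw [Prod.smul_fst, h3, Pi.smul_apply, WithLp.ofLp_smul, h1, Pi.smul_apply]
    · filter_upwards [hy2, Lp.coeFn_smul c a.2, ae_differentiableAt hy] with x h1 h3 h4
      simp only [Prod.smul_snd, h3, Pi.smul_apply, WithLp.ofLp_smul, h1, diffExpr,
        deriv_const_smul c h4, Matrix.mulVec_smul, smul_add]

/-- The operator `L_t(Q)` in `L₂²[0, π]` generated by `l(y, Q)` and `y(π) = e^{iπt} y(0)`.
Its graph is `graph p q t`, see `graph_operator`. -/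
def operator (p q : ℝ → ℂ) (t : ℂ) : L2 →ₗ.[ℂ] L2 := (graph p q t).toLinearPMap

theorem graph_functional (p q : ℝ → ℂ) (t : ℂ) :
    ∀ fg ∈ graph p q t, fg.1 = 0 → fg.2 = 0 := by
  rintro ⟨f, g⟩ ⟨y, ⟨hy, -⟩, h1, h2⟩ (rfl : f = 0)
  have hI : mu = volume.restrict (Set.Ioo 0 Real.pi) :=
    (Measure.restrict_congr_set Ioo_ae_eq_Icc).symm
  have hc : ContinuousOn y (Set.Ioo 0 Real.pi) :=
    hy.continuousOn.mono (by rw [Set.uIcc_of_le Real.pi_pos.le]; exact Set.Ioo_subset_Icc_self)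
  have h3 : ∀ᵐ x ∂mu, y x = 0 := by
    filter_upwards [h1, Lp.coeFn_zero (EuclideanSpace ℂ (Fin 2)) 2 mu] with x hx hx'
    exact hx.symm.trans (congrArg WithLp.ofLp hx')
  rw [hI] at h3
  have h4 : Set.EqOn y (fun _ => 0) (Set.Ioo 0 Real.pi) :=
    Measure.eqOn_open_of_ae_eq h3 isOpen_Ioo hc continuousOn_const
  have h5 : ∀ᵐ x ∂mu, x ∈ Set.Ioo 0 Real.pi := by
    rw [hI]
    exact ae_restrict_mem measurableSet_Ioo
  refine (Lp.eq_zero_iff_ae_eq_zero).2 ?_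
  filter_upwards [h2, h5] with x hx hx'
  have hd : deriv y x = 0 := by
    have : y =ᶠ[nhds x] fun _ => 0 := h4.eventuallyEq_of_mem (isOpen_Ioo.mem_nhds hx')
    rw [this.deriv_eq, deriv_const]
  have h6 : (g x).ofLp = 0 := by
    rw [hx, diffExpr, hd, h4 hx']
    simp
  exact (WithLp.ofLp_eq_zero 2).1 h6

theorem graph_operator (p q : ℝ → ℂ) (t : ℂ) : (operator p q t).graph = graph p q t :=
  Submodule.toLinearPMap_graph_eq _ (graph_functional p q t)

/-- `μ` is an eigenvalue of the operator `T`. -/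
def IsEigenvalue (T : L2 →ₗ.[ℂ] L2) (μ : ℂ) : Prop :=
  ∃ f : T.domain, f ≠ 0 ∧ T f = μ • (f : L2)

/-- The kernel of `(T - μ)^k`, with its natural domain. -/
def kerPow (T : L2 →ₗ.[ℂ] L2) (μ : ℂ) : ℕ → Submodule ℂ L2
  | 0 => ⊥
  | k + 1 => ((kerPow T μ k).comap (T.toFun - μ • T.domain.subtype)).map T.domain.subtype

/-- The (algebraic) multiplicity of `μ`: the dimension of the root space, that is of the space
of all eigenfunctions and associated functions of `T` at `μ`. It is `0` if there are none. -/
def multiplicity (T : L2 →ₗ.[ℂ] L2) (μ : ℂ) : ℕ∞ :=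
  Cardinal.toENat (Module.rank ℂ (⨆ k, kerPow T μ k : Submodule ℂ L2))

/-- The set `D_h(0, 1) = D_h \ (U_h(0) ∪ U_h(1))`. -/
def region (h : ℝ) : Set ℂ :=
  {t : ℂ | |t.im| ≤ 2 * h ∧ -h ≤ t.re ∧ t.re ≤ 2 - h} \ (Metric.ball 0 h ∪ Metric.ball 1 h)

end Dirac

end

/- For every `lam` the system `l(y, Q) = lam y` is a Volterra equation of the second kind, solved by
a Neumann series which is entire in `lam`. Its monodromy matrix has determinant `1`, so `lam` is an
eigenvalue of `L_t(Q)` if and only if `χ_t(lam) = 2 cos(πt) - D(lam) = 0`, where `D` is the trace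
of the monodromy. Away from the integers the monodromy is never scalar, so eigenvalues are
geometrically simple, and the Taylor coefficients in `lam` of a family of solutions obtained from
the adjugate of the boundary matrix form a Jordan chain which breaks off exactly at the order of
the zero of `χ_t`: the algebraic multiplicity is the order of the zero.

Bounded variation makes the Fourier-type integrals of `p` and `q` of size `O(1 / lam)`, whence
`D(lam) = 2 cos(π lam) + O(e^{π |Im lam|} / |lam|)`. Rouché's theorem then pairs the zeros of `χ_t`
with those of `2 cos(πt) - 2 cos(π lam)`, which are `2n ± t`; these are simple and uniformly
separated as long as `t` stays away from the integers. -/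

section EntireFunctions

variable {f g : ℂ → ℂ} {s : Set ℂ} {c : ℂ} {R : ℝ}

theorem analyticOrderAt_ne_top_of_differentiable (hf : Differentiable ℂ f) (hf₀ : f ≠ 0) (w : ℂ) :
    analyticOrderAt f w ≠ ⊤ := fun h ↦
  hf₀ ((AnalyticOnNhd.analyticOrderAt_eq_top_iff_eq_zero w hf.analyticAt).1 h)

theorem analyticOrderNatAt_ne_zero_iff (hf : Differentiable ℂ f) (hf₀ : f ≠ 0) {w : ℂ} :
    analyticOrderNatAt f w ≠ 0 ↔ f w = 0 := by
  rw [← (hf.analyticAt w).analyticOrderAt_ne_zero,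
    ← Nat.cast_analyticOrderNatAt (analyticOrderAt_ne_top_of_differentiable hf hf₀ w),
    Nat.cast_ne_zero]

theorem finite_inter_support_analyticOrderNatAt (hf : Differentiable ℂ f) (hf₀ : f ≠ 0)
    (hs : Bornology.IsBounded s) : (s ∩ Function.support (analyticOrderNatAt f)).Finite := by
  obtain ⟨x, hx⟩ := Function.ne_iff.1 hf₀
  have hcod := (Complex.analyticOnNhd_univ_iff_differentiable.2 hf).preimage_zero_mem_codiscrete hx
  refine (hs.isCompact_closure.finite_sdiff_of_mem_codiscreteWithin
    (Filter.codiscreteWithin_mono (Set.subset_univ _) hcod)).subset ?_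
  rintro w ⟨hws, hw⟩
  exact ⟨subset_closure hws, fun h ↦ h ((analyticOrderNatAt_ne_zero_iff hf hf₀).1 hw)⟩

/-- The number of zeros of `f` in `s`, counted with multiplicity. It has the junk value `0` if `s`
contains infinitely many zeros. -/
noncomputable def zeroCount (f : ℂ → ℂ) (s : Set ℂ) : ℕ := ∑ᶠ w ∈ s, analyticOrderNatAt f w

theorem zeroCount_eq_zero_iff (hf : Differentiable ℂ f) (hf₀ : f ≠ 0)
    (hs : Bornology.IsBounded s) : zeroCount f s = 0 ↔ ∀ w ∈ s, f w ≠ 0 := by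
  rw [zeroCount, finsum_mem_eq_sum _
    (finite_inter_support_analyticOrderNatAt hf hf₀ hs), Finset.sum_eq_zero_iff]
  simp only [Set.Finite.mem_toFinset, Set.mem_inter_iff, Function.mem_support, ne_eq]
  refine forall_congr' fun w ↦ ?_
  have := analyticOrderNatAt_ne_zero_iff hf hf₀ (w := w)
  tauto

theorem analyticOrderNatAt_sub_mul (hg : Differentiable ℂ g) (hg₀ : g ≠ 0) (a w : ℂ) :
    analyticOrderNatAt (fun z ↦ (z - a) * g z) w =
      (if w = a then 1 else 0) + analyticOrderNatAt g w := by
  have hlin : Differentiable ℂ fun z : ℂ ↦ z - a := by fun_prop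
  have horder : analyticOrderAt (fun z : ℂ ↦ z - a) w = (if w = a then 1 else 0 : ℕ) := by
    split_ifs with h
    · refine (hlin.analyticAt w).analyticOrderAt_eq_one_of_zero_deriv_ne_zero (by simp [h]) ?_
      simp
    · exact (hlin.analyticAt w).analyticOrderAt_eq_zero.2 (sub_ne_zero.2 h)
  have hmul : analyticOrderAt (fun z ↦ (z - a) * g z) w =
      analyticOrderAt (fun z : ℂ ↦ z - a) w + analyticOrderAt g w :=
    analyticOrderAt_mul (hlin.analyticAt w) (hg.analyticAt w)
  rw [analyticOrderNatAt, hmul, horder,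
    ENat.toNat_add (ENat.natCast_ne_top _) (analyticOrderAt_ne_top_of_differentiable hg hg₀ w),
    ENat.toNat_natCast, analyticOrderNatAt]

theorem zeroCount_sub_mul (hg : Differentiable ℂ g) (hg₀ : g ≠ 0) (hs : Bornology.IsBounded s)
    {a : ℂ} (ha : a ∈ s) : zeroCount (fun z ↦ (z - a) * g z) s = zeroCount g s + 1 := by
  have hsupp : (s ∩ Function.support fun w ↦ if w = a then 1 else 0).Finite :=
    (Set.finite_singleton a).subset fun w hw ↦ by simpa using hw.2
  simp only [zeroCount, analyticOrderNatAt_sub_mul hg hg₀]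
  rw [finsum_mem_add_distrib' hsupp (finite_inter_support_analyticOrderNatAt hg hg₀ hs), add_comm,
    finsum_eq_single (fun w ↦ ∑ᶠ _ : w ∈ s, if w = a then 1 else 0) a fun w hw ↦ by simp [hw]]
  simp [ha]

theorem ne_zero_of_forall_mem_sphere (hR : 0 < R) (hs : ∀ z ∈ Metric.sphere c R, f z ≠ 0) :
    f ≠ 0 := by
  rintro rfl
  exact hs (c + R) (by simp [abs_of_pos hR]) rfl

theorem circleIntegrable_logDeriv (hR : 0 ≤ R) (hf : Differentiable ℂ f)
    (hs : ∀ z ∈ Metric.sphere c R, f z ≠ 0) : CircleIntegrable (logDeriv f) c R :=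
  (hf.deriv.continuous.continuousOn.div hf.continuous.continuousOn hs).circleIntegrable hR

theorem circleIntegral_logDeriv_eq_zero (hR : 0 ≤ R) (hf : Differentiable ℂ f)
    (h : ∀ z ∈ Metric.closedBall c R, f z ≠ 0) : (∮ z in C(c, R), logDeriv f z) = 0 :=
  Complex.circleIntegral_eq_zero_of_differentiable_on_off_countable hR Set.countable_empty
    (hf.deriv.continuous.continuousOn.div hf.continuous.continuousOn h)
    fun z hz ↦ (hf.deriv z).div (hf z) (h z (Metric.ball_subset_closedBall hz.1))

theorem circleIntegral_logDeriv_sub_mul (hR : 0 < R) {a : ℂ} (ha : a ∈ Metric.ball c R)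
    (hg : Differentiable ℂ g) (hs : ∀ z ∈ Metric.sphere c R, g z ≠ 0) :
    (∮ z in C(c, R), logDeriv (fun z ↦ (z - a) * g z) z) =
      2 * Real.pi * Complex.I + ∮ z in C(c, R), logDeriv g z := by
  have hne : ∀ z ∈ Metric.sphere c R, z - a ≠ 0 := by
    rintro z hz h
    rw [sub_eq_zero.1 h, Metric.mem_sphere] at hz
    exact (Metric.mem_ball.1 ha).ne hz
  have hlog : ∀ z ∈ Metric.sphere c R,
      logDeriv (fun z ↦ (z - a) * g z) z = (z - a)⁻¹ + logDeriv g z := by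
    intro z hz
    rw [logDeriv_mul z (hne z hz) (hs z hz) (by fun_prop) (hg z)]
    simp [logDeriv_apply]
  have hint : CircleIntegrable (fun z ↦ (z - a)⁻¹) c R :=
    ContinuousOn.circleIntegrable hR.le (ContinuousOn.inv₀ (by fun_prop) hne)
  rw [circleIntegral.integral_congr hR.le hlog,
    circleIntegral.integral_add hint (circleIntegrable_logDeriv hR.le hg hs),
    circleIntegral.integral_sub_inv_of_mem_ball ha]

theorem circleIntegral_logDeriv_eq_zeroCount (hR : 0 < R) (hf : Differentiable ℂ f)
    (hs : ∀ z ∈ Metric.sphere c R, f z ≠ 0) :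
    (∮ z in C(c, R), logDeriv f z) =
      2 * Real.pi * Complex.I * zeroCount f (Metric.ball c R) := by
  obtain ⟨n, hn⟩ : ∃ n, zeroCount f (Metric.ball c R) = n := ⟨_, rfl⟩
  induction n generalizing f with
  | zero =>
    have hball := (zeroCount_eq_zero_iff hf (ne_zero_of_forall_mem_sphere hR hs)
      Metric.isBounded_ball).1 hn
    rw [hn, Nat.cast_zero, mul_zero]
    refine circleIntegral_logDeriv_eq_zero hR.le hf fun z hz ↦ ?_
    rcases Metric.ball_union_sphere (x := c) (ε := R) ▸ hz with hz | hz
    exacts [hball z hz, hs z hz]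
  | succ n ih =>
    have hf₀ := ne_zero_of_forall_mem_sphere hR hs
    obtain ⟨a, ha, hfa⟩ : ∃ a ∈ Metric.ball c R, f a = 0 := by
      by_contra! h
      rw [(zeroCount_eq_zero_iff hf hf₀ Metric.isBounded_ball).2 h] at hn
      exact absurd hn n.succ_ne_zero.symm
    have hg : Differentiable ℂ (dslope f a) := differentiableOn_univ.1
      ((Complex.differentiableOn_dslope Filter.univ_mem).2 hf.differentiableOn)
    have hfg : f = fun z ↦ (z - a) * dslope f a z :=
      funext fun z ↦ (sub_smul_dslope_of_zero hfa z).symm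
    have hgs : ∀ z ∈ Metric.sphere c R, dslope f a z ≠ 0 := by
      intro z hz h
      rw [hfg] at hs
      exact hs z hz (by simp only [h, mul_zero])
    have hcount := zeroCount_sub_mul hg (ne_zero_of_forall_mem_sphere hR hgs)
      Metric.isBounded_ball ha
    rw [← hfg] at hcount
    have hint := circleIntegral_logDeriv_sub_mul hR ha hg hgs
    rw [← hfg, ih hg hgs (by lia)] at hint
    rw [hint, hcount]
    push_cast
    ring

theorem zeroCount_ball_eq_of_norm_sub_lt (hR : 0 < R) (hf : Differentiable ℂ f)
    (hg : Differentiable ℂ g) (hfg : ∀ z ∈ Metric.sphere c R, ‖f z - g z‖ < ‖g z‖) :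
    zeroCount f (Metric.ball c R) = zeroCount g (Metric.ball c R) := by
  have hg₀ : ∀ z ∈ Metric.sphere c R, g z ≠ 0 := fun z hz ↦
    norm_pos_iff.1 ((norm_nonneg _).trans_lt (hfg z hz))
  have hf₀ : ∀ z ∈ Metric.sphere c R, f z ≠ 0 := fun z hz h ↦ by
    simpa [h] using hfg z hz
  -- `f / g` maps the circle into the slit plane, so `log (f / g)` is a primitive.
  have hlog : ∀ z ∈ Metric.sphere c R, HasDerivWithinAt (fun z ↦ Complex.log (f z / g z))
      (logDeriv f z - logDeriv g z) (Metric.sphere c R) z := by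
    intro z hz
    have hslit : f z / g z ∈ Complex.slitPlane := by
      refine Complex.ball_one_subset_slitPlane ?_
      rw [mem_ball_iff_norm, div_sub_one (hg₀ z hz), norm_div,
        div_lt_one (norm_pos_iff.2 (hg₀ z hz))]
      exact hfg z hz
    have hderiv := ((hf z).hasDerivAt.div (hg z).hasDerivAt (hg₀ z hz)).clog hslit
    refine hderiv.hasDerivWithinAt.congr_deriv ?_
    have := hf₀ z hz
    have := hg₀ z hz
    simp only [logDeriv_apply, Pi.div_apply]
    field_simp
  have hint := circleIntegral.integral_eq_zero_of_hasDerivWithinAt hR.le hlog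
  rw [circleIntegral.integral_sub (circleIntegrable_logDeriv hR.le hf hf₀)
    (circleIntegrable_logDeriv hR.le hg hg₀), circleIntegral_logDeriv_eq_zeroCount hR hf hf₀,
    circleIntegral_logDeriv_eq_zeroCount hR hg hg₀, sub_eq_zero] at hint
  exact_mod_cast mul_left_cancel₀ Complex.two_pi_I_ne_zero hint

end EntireFunctions

section EnumeratesZeros

variable {ι κ : Type*} {f g : ℂ → ℂ} {z : ι → ℂ} {s : Set ℂ}

/-- The family `z` lists all zeros of `f`, each one as often as its multiplicity. -/
def EnumeratesZeros (f : ℂ → ℂ) (z : ι → ℂ) : Prop :=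
  ∀ w, analyticOrderAt f w = {i | z i = w}.encard

namespace EnumeratesZeros

theorem comp_equiv (hz : EnumeratesZeros f z) (e : κ ≃ ι) : EnumeratesZeros f (z ∘ e) := fun w ↦ by
  rw [hz w, ← Set.encard_preimage_of_bijective e.bijective]
  rfl

theorem eq_zero (hz : EnumeratesZeros f z) (i : ι) : f (z i) = 0 := by
  have hne : analyticOrderAt f (z i) ≠ 0 := by
    rw [hz, Set.encard_ne_zero]
    exact ⟨i, rfl⟩
  exact apply_eq_zero_of_analyticOrderAt_ne_zero hne

theorem eq_zero_iff (hz : EnumeratesZeros f z) (hf : Differentiable ℂ f) {w : ℂ} :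
    f w = 0 ↔ ∃ i, z i = w := by
  rw [← (hf.analyticAt w).analyticOrderAt_ne_zero, hz, Set.encard_ne_zero]
  rfl

theorem ne_zero [Countable ι] (hz : EnumeratesZeros f z) : f ≠ 0 := by
  rintro rfl
  have hsurj : Function.Surjective z := fun w ↦ (hz.eq_zero_iff (differentiable_const 0)).1 rfl
  exact not_countable_complex (Set.countable_univ_iff.2 hsurj.countable)

theorem encard_preimage (hz : EnumeratesZeros f z) (hf : Differentiable ℂ f) (hf₀ : f ≠ 0)
    (hs : Bornology.IsBounded s) : (z ⁻¹' s).encard = zeroCount f s := by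
  have hfin := finite_inter_support_analyticOrderNatAt hf hf₀ hs
  have hunion : z ⁻¹' s =
      ⋃ w ∈ s ∩ Function.support (analyticOrderNatAt f), {i | z i = w} := by
    ext i
    simp [analyticOrderNatAt_ne_zero_iff hf hf₀ |>.2 (hz.eq_zero i)]
  have hdisj : (s ∩ Function.support (analyticOrderNatAt f)).PairwiseDisjoint
      fun w ↦ {i | z i = w} :=
    fun v _ w _ hvw ↦ Set.disjoint_left.2 fun i hv hw ↦ hvw (hv.symm.trans hw)
  rw [hunion, hfin.encard_biUnion hdisj, zeroCount,
    finsum_mem_eq_finite_toFinset_sum _ hfin,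
    finsum_mem_eq_sum _ hfin, Nat.cast_sum]
  refine Finset.sum_congr rfl fun w _ ↦ ?_
  rw [← hz, Nat.cast_analyticOrderNatAt (analyticOrderAt_ne_top_of_differentiable hf hf₀ w)]

end EnumeratesZeros

theorem enumeratesZeros_sigma_fst (hf : Differentiable ℂ f) (hf₀ : f ≠ 0) :
    EnumeratesZeros f (Sigma.fst : (Σ w, Fin (analyticOrderNatAt f w)) → ℂ) := fun w ↦ by
  have hcard : {i : Σ w, Fin (analyticOrderNatAt f w) | i.1 = w}.encard =
      ENat.card (Fin (analyticOrderNatAt f w)) :=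
    ENat.card_congr (Equiv.sigmaSubtype w)
  rw [hcard, ENat.card_eq_coe_fintype_card, Fintype.card_fin,
    Nat.cast_analyticOrderNatAt (analyticOrderAt_ne_top_of_differentiable hf hf₀ w)]

theorem exists_equiv_of_encard_preimage_eq {J α : Type*} {U : J → Set α} {x : ι → α} {y : κ → α}
    (hdisj : Pairwise (Function.onFun Disjoint U)) (hx : ∀ i, ∃ j, x i ∈ U j)
    (hy : ∀ k, ∃ j, y k ∈ U j) (hfin : ∀ j, (x ⁻¹' U j).Finite)
    (hcard : ∀ j, (x ⁻¹' U j).encard = (y ⁻¹' U j).encard) :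
    ∃ e : ι ≃ κ, ∀ i j, x i ∈ U j → y (e i) ∈ U j := by
  choose a ha using hx
  choose b hb using hy
  have huniq : ∀ {w j j'}, w ∈ U j → w ∈ U j' → j = j' := fun hj hj' ↦
    hdisj.eq (Set.not_disjoint_iff.2 ⟨_, hj, hj'⟩)
  have hfiber : ∀ j, Nonempty ({i // a i = j} ≃ {k // b k = j}) := by
    intro j
    have hxa : x ⁻¹' U j = {i | a i = j} :=
      Set.ext fun i ↦ ⟨fun hi ↦ huniq (ha i) hi, fun hi ↦ hi ▸ ha i⟩
    have hyb : y ⁻¹' U j = {k | b k = j} :=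
      Set.ext fun k ↦ ⟨fun hk ↦ huniq (hb k) hk, fun hk ↦ hk ▸ hb k⟩
    have hc := hcard j
    have hf := hfin j
    rw [hxa] at hf
    rw [hxa, hyb] at hc
    have : Finite {i // a i = j} := hf
    have : Finite {k // b k = j} :=
      Set.finite_of_encard_eq_coe (hc.symm.trans hf.cast_ncard_eq.symm)
    have hcard' : Nat.card {i // a i = j} = Nat.card {k // b k = j} := congrArg ENat.toNat hc
    exact ⟨(Finite.equivFinOfCardEq hcard').trans (Finite.equivFin _).symm⟩
  let e := Equiv.ofFiberEquiv fun j ↦ (hfiber j).some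
  refine ⟨e, fun i j hij ↦ ?_⟩
  have hei : b (e i) = a i := Equiv.ofFiberEquiv_map _ i
  rw [huniq hij (ha i), ← hei]
  exact hb (e i)

theorem EnumeratesZeros.exists_of_zeroCount_eq {J : Type*} {U : J → Set ℂ}
    (hz : EnumeratesZeros g z) (hf : Differentiable ℂ f) (hf₀ : f ≠ 0) (hg : Differentiable ℂ g)
    (hg₀ : g ≠ 0) (hdisj : Pairwise (Function.onFun Disjoint U))
    (hU : ∀ j, Bornology.IsBounded (U j)) (hcount : ∀ j, zeroCount f (U j) = zeroCount g (U j))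
    (hzU : ∀ i, ∃ j, z i ∈ U j) (hfU : ∀ w, f w = 0 → ∃ j, w ∈ U j) :
    ∃ y : ι → ℂ, EnumeratesZeros f y ∧ ∀ i j, z i ∈ U j → y i ∈ U j := by
  have hy := enumeratesZeros_sigma_fst hf hf₀
  have hcard : ∀ j, (z ⁻¹' U j).encard = zeroCount g (U j) := fun j ↦
    hz.encard_preimage hg hg₀ (hU j)
  obtain ⟨e, he⟩ := exists_equiv_of_encard_preimage_eq hdisj hzU (fun k ↦ hfU _ (hy.eq_zero k))
    (fun j ↦ Set.finite_of_encard_eq_coe (hcard j))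
    (fun j ↦ by rw [hcard, hy.encard_preimage hf hf₀ (hU j), hcount])
  exact ⟨_, hy.comp_equiv e, he⟩

section DiscCover

variable {R d : ℝ}

/-- The disc of radius `R` about the origin, together with the discs of radius `d` about those
points of the family `z` that lie outside it. -/
def discCover (z : ι → ℂ) (R d : ℝ) : Option {i // R < ‖z i‖} → Set ℂ :=
  fun o ↦ o.elim (Metric.ball 0 R) fun i ↦ Metric.ball (z i) d

theorem abs_norm_sub_norm_le_dist (w v : ℂ) : |‖w‖ - ‖v‖| ≤ dist w v := by
  simpa [dist_eq_norm] using abs_norm_sub_norm_le w v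

theorem add_le_norm_of_sub_lt_norm (hgap : ∀ i, d ≤ |‖z i‖ - R|) {i : ι} (hi : R - d < ‖z i‖) :
    R + d ≤ ‖z i‖ := by
  rcases le_abs.1 (hgap i) with h | h <;> linarith

theorem pairwise_disjoint_discCover (hd : 0 < d)
    (hsep : Pairwise fun i j ↦ d + d ≤ dist (z i) (z j)) (hgap : ∀ i, d ≤ |‖z i‖ - R|) :
    Pairwise (Function.onFun Disjoint (discCover z R d)) := by
  have hball : ∀ i : {i // R < ‖z i‖}, Disjoint (Metric.ball 0 R) (Metric.ball (z i) d) := by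
    intro i
    refine Metric.ball_disjoint_ball ?_
    rw [dist_zero_left]
    exact add_le_norm_of_sub_lt_norm hgap (by linarith [i.2])
  rintro (_ | i) (_ | j) hij
  · exact absurd rfl hij
  · exact hball j
  · exact (hball i).symm
  · exact Metric.ball_disjoint_ball (hsep fun h ↦ hij (congrArg some (Subtype.ext h)))

theorem le_dist_of_mem_sphere_zero (hgap : ∀ i, d ≤ |‖z i‖ - R|) {w : ℂ}
    (hw : w ∈ Metric.sphere 0 R) (i : ι) : d ≤ dist w (z i) := by
  rw [mem_sphere_zero_iff_norm] at hw
  refine (hgap i).trans ?_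
  rw [abs_sub_comm, ← hw]
  exact abs_norm_sub_norm_le_dist w (z i)

theorem le_dist_of_mem_sphere (hsep : Pairwise fun i j ↦ d + d ≤ dist (z i) (z j)) {i : ι} {w : ℂ}
    (hw : w ∈ Metric.sphere (z i) d) (j : ι) : d ≤ dist w (z j) := by
  rw [Metric.mem_sphere] at hw
  rcases eq_or_ne i j with rfl | hij
  · exact hw.ge
  · linarith [hsep hij, dist_triangle_left (z i) (z j) w]

theorem le_norm_of_mem_sphere (hd : 0 < d) (hgap : ∀ i, d ≤ |‖z i‖ - R|) {i : ι}
    (hi : R < ‖z i‖) {w : ℂ} (hw : w ∈ Metric.sphere (z i) d) : R ≤ ‖w‖ := by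
  rw [Metric.mem_sphere] at hw
  linarith [neg_abs_le (‖w‖ - ‖z i‖), abs_norm_sub_norm_le_dist w (z i),
    add_le_norm_of_sub_lt_norm hgap (show R - d < ‖z i‖ by linarith)]

theorem exists_mem_discCover (hd : 0 < d) (hgap : ∀ i, d ≤ |‖z i‖ - R|) {w : ℂ}
    (hw : R ≤ ‖w‖ → ∃ i, dist w (z i) < d) : ∃ o, w ∈ discCover z R d o := by
  rcases lt_or_ge ‖w‖ R with hwR | hwR
  · exact ⟨none, mem_ball_zero_iff.2 hwR⟩
  · obtain ⟨i, hi⟩ := hw hwR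
    have hzi : R - d < ‖z i‖ := by
      linarith [le_abs_self (‖w‖ - ‖z i‖), abs_norm_sub_norm_le_dist w (z i)]
    exact ⟨some ⟨i, by linarith [add_le_norm_of_sub_lt_norm hgap hzi]⟩, hi⟩

theorem EnumeratesZeros.exists_near (hz : EnumeratesZeros g z) (hR : 0 < R) (hd : 0 < d)
    (hf : Differentiable ℂ f) (hg : Differentiable ℂ g)
    (hsep : Pairwise fun i j ↦ d + d ≤ dist (z i) (z j)) (hgap : ∀ i, d ≤ |‖z i‖ - R|)
    (hfg : ∀ w, R ≤ ‖w‖ → (∀ i, d ≤ dist w (z i)) → ‖f w - g w‖ < ‖g w‖) :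
    ∃ y : ι → ℂ, EnumeratesZeros f y ∧ ∀ i, R < ‖z i‖ → dist (y i) (z i) < d := by
  have hfg_R : ∀ w ∈ Metric.sphere (0 : ℂ) R, ‖f w - g w‖ < ‖g w‖ := fun w hw ↦
    hfg w (mem_sphere_zero_iff_norm.1 hw).ge (le_dist_of_mem_sphere_zero hgap hw)
  have hg₀ : g ≠ 0 := ne_zero_of_forall_mem_sphere hR fun w hw ↦
    norm_pos_iff.1 ((norm_nonneg _).trans_lt (hfg_R w hw))
  have hf₀ : f ≠ 0 := ne_zero_of_forall_mem_sphere hR fun w hw h ↦ by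
    simpa [h] using hfg_R w hw
  have hbdd : ∀ o, Bornology.IsBounded (discCover z R d o) := by
    rintro (_ | i) <;> exact Metric.isBounded_ball
  have hcount : ∀ o, zeroCount f (discCover z R d o) = zeroCount g (discCover z R d o) := by
    rintro (_ | i)
    · exact zeroCount_ball_eq_of_norm_sub_lt hR hf hg hfg_R
    · exact zeroCount_ball_eq_of_norm_sub_lt hd hf hg fun w hw ↦
        hfg w (le_norm_of_mem_sphere hd hgap i.2 hw) (le_dist_of_mem_sphere hsep hw)
  have hz_mem : ∀ i, ∃ o, z i ∈ discCover z R d o := fun i ↦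
    exists_mem_discCover hd hgap fun _ ↦ ⟨i, by rwa [dist_self]⟩
  have hf_mem : ∀ w, f w = 0 → ∃ o, w ∈ discCover z R d o := fun w hw ↦
    exists_mem_discCover hd hgap fun hwR ↦ by
      by_contra! h
      simpa [hw] using hfg w hwR h
  obtain ⟨y, hy, hyU⟩ := hz.exists_of_zeroCount_eq hf hf₀ hg hg₀
    (pairwise_disjoint_discCover hd hsep hgap) hbdd hcount hz_mem hf_mem
  exact ⟨y, hy, fun i hi ↦ hyU i (some ⟨i, hi⟩) (Metric.mem_ball_self hd)⟩

end DiscCover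

end EnumeratesZeros

section Sine

theorem norm_sin_sq (z : ℂ) :
    ‖Complex.sin z‖ ^ 2 = Real.sin z.re ^ 2 + Real.sinh z.im ^ 2 := by
  have hsin : Complex.sin z = ((Real.sin z.re * Real.cosh z.im : ℝ) : ℂ) +
      ((Real.cos z.re * Real.sinh z.im : ℝ) : ℂ) * Complex.I := by
    rw [Complex.sin_eq z]
    push_cast
    rfl
  rw [hsin, ← Complex.normSq_eq_norm_sq, Complex.normSq_add_mul_I]
  linear_combination Real.sin z.re ^ 2 * Real.cosh_sq z.im +
    Real.sinh z.im ^ 2 * Real.sin_sq_add_cos_sq z.re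

theorem sinh_abs_im_le_norm_sin (z : ℂ) : Real.sinh |z.im| ≤ ‖Complex.sin z‖ := by
  refine le_of_sq_le_sq ?_ (norm_nonneg _)
  rw [norm_sin_sq, ← Real.abs_sinh, sq_abs]
  exact le_add_of_nonneg_left (sq_nonneg _)

theorem two_div_pi_mul_norm_le_norm_sin {z : ℂ} (hz : |z.re| ≤ Real.pi / 2) :
    2 / Real.pi * ‖z‖ ≤ ‖Complex.sin z‖ := by
  refine le_of_sq_le_sq ?_ (norm_nonneg _)
  have hre : (2 / Real.pi * |z.re|) ^ 2 ≤ Real.sin z.re ^ 2 :=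
    sq_le_sq.2 ((abs_of_nonneg (by positivity)).trans_le (Real.mul_abs_le_abs_sin hz))
  have him : |z.im| ^ 2 ≤ Real.sinh z.im ^ 2 := by
    refine sq_le_sq.2 ?_
    rw [abs_abs, Real.abs_sinh]
    exact Real.self_le_sinh_iff.2 (abs_nonneg _)
  have hpi : (2 / Real.pi) ^ 2 ≤ 1 :=
    pow_le_one₀ (by positivity) ((div_le_one Real.pi_pos).2 Real.two_le_pi)
  rw [mul_pow, sq_abs] at hre
  rw [sq_abs] at him
  rw [norm_sin_sq, mul_pow, ← Complex.normSq_eq_norm_sq, Complex.normSq_apply]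
  nlinarith [sq_nonneg z.im]

theorem exp_div_three_le_sinh {b : ℝ} (hb : 1 ≤ b) : Real.exp b / 3 ≤ Real.sinh b := by
  have hprod : Real.exp b = Real.exp (2 * b) * Real.exp (-b) := by
    rw [← Real.exp_add]
    ring_nf
  have h3 : 3 ≤ Real.exp (2 * b) := by linarith [Real.add_one_le_exp (2 * b)]
  have := mul_le_mul_of_nonneg_right h3 (Real.exp_pos (-b)).le
  rw [Real.sinh_eq]
  linarith

theorem min_one_norm_mul_exp_le_norm_sin {z : ℂ} (hz : |z.re| ≤ Real.pi / 2) :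
    1 / 5 * min 1 ‖z‖ * Real.exp |z.im| ≤ ‖Complex.sin z‖ := by
  have hexp := Real.exp_pos |z.im|
  rcases le_total |z.im| 1 with him | him
  · have h3 : Real.exp |z.im| ≤ 3 :=
      (Real.exp_le_exp.2 him).trans (Real.exp_one_lt_d9.le.trans (by norm_num))
    have hpi : 3 / 5 ≤ 2 / Real.pi :=
      (div_le_div_iff₀ (by norm_num) Real.pi_pos).2 (by linarith [Real.pi_lt_d2])
    calc 1 / 5 * min 1 ‖z‖ * Real.exp |z.im| ≤ 1 / 5 * ‖z‖ * 3 := by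
          gcongr
          exact min_le_right _ _
      _ = 3 / 5 * ‖z‖ := by ring
      _ ≤ 2 / Real.pi * ‖z‖ := by gcongr
      _ ≤ ‖Complex.sin z‖ := two_div_pi_mul_norm_le_norm_sin hz
  · calc 1 / 5 * min 1 ‖z‖ * Real.exp |z.im| ≤ 1 / 5 * 1 * Real.exp |z.im| := by
          gcongr
          exact min_le_left _ _
      _ ≤ Real.exp |z.im| / 3 := by linarith
      _ ≤ Real.sinh |z.im| := exp_div_three_le_sinh him
      _ ≤ ‖Complex.sin z‖ := sinh_abs_im_le_norm_sin z

theorem norm_sin_sub_int_mul_pi (z : ℂ) (n : ℤ) :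
    ‖Complex.sin (z - n * Real.pi)‖ = ‖Complex.sin z‖ := by
  rw [Complex.sin_antiperiodic.sub_int_mul_eq, norm_mul]
  rcases Int.units_eq_one_or n.negOnePow with h | h <;> simp [h]

theorem exists_min_one_norm_sub_mul_exp_le_norm_sin (z : ℂ) : ∃ n : ℤ,
    1 / 5 * min 1 ‖z - 2 * n‖ * Real.exp (Real.pi / 2 * |z.im|) ≤
      ‖Complex.sin (Real.pi / 2 * z)‖ := by
  set n := round (z.re / 2)
  have hscale : (Real.pi / 2 * z - n * Real.pi : ℂ) = (Real.pi / 2 : ℝ) * (z - 2 * n) := by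
    push_cast
    ring
  have hre : |(z - 2 * n).re| ≤ 1 := by
    have hsub : (z - 2 * n).re = 2 * (z.re / 2 - n) := by
      simp
      ring
    rw [hsub, abs_mul, abs_two]
    linarith [abs_sub_round (z.re / 2)]
  have hpi : 1 ≤ Real.pi / 2 := by linarith [Real.two_le_pi]
  have hle : |((Real.pi / 2 : ℝ) * (z - 2 * n) : ℂ).re| ≤ Real.pi / 2 := by
    rw [Complex.re_ofReal_mul, abs_mul, abs_of_pos (by positivity)]
    nlinarith
  have him : |((Real.pi / 2 : ℝ) * (z - 2 * n) : ℂ).im| = Real.pi / 2 * |z.im| := by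
    rw [Complex.im_ofReal_mul, abs_mul, abs_of_pos (by positivity)]
    simp
  have hnorm : ‖z - 2 * n‖ ≤ ‖((Real.pi / 2 : ℝ) * (z - 2 * n) : ℂ)‖ := by
    rw [norm_mul, Complex.norm_of_nonneg (by positivity)]
    exact le_mul_of_one_le_left (norm_nonneg _) hpi
  refine ⟨n, ?_⟩
  rw [← norm_sin_sub_int_mul_pi _ n, hscale, ← him]
  refine le_trans ?_ (min_one_norm_mul_exp_le_norm_sin hle)
  gcongr

end Sine

namespace Dirac

/-- The eigenvalues `2n + t` and `2n - t` of the operator with zero potential. -/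
noncomputable def freeRoot (t : ℂ) : ℤ ⊕ ℤ → ℂ :=
  Sum.elim (fun n ↦ 2 * n + t) fun n ↦ 2 * n - t

/-- The characteristic function of the operator with zero potential. -/
noncomputable def freeChar (t lam : ℂ) : ℂ :=
  2 * Complex.cos (Real.pi * t) - 2 * Complex.cos (Real.pi * lam)

variable {t : ℂ} {δ : ℝ}

theorem differentiable_freeChar (t : ℂ) : Differentiable ℂ (freeChar t) := by
  unfold freeChar
  fun_prop

theorem freeChar_eq_mul_sin (t lam : ℂ) : freeChar t lam =
    4 * Complex.sin (Real.pi / 2 * (lam + t)) * Complex.sin (Real.pi / 2 * (lam - t)) := by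
  have ht : (Real.pi * t : ℂ) = Real.pi / 2 * (lam + t) - Real.pi / 2 * (lam - t) := by ring
  have hlam : (Real.pi * lam : ℂ) = Real.pi / 2 * (lam + t) + Real.pi / 2 * (lam - t) := by ring
  rw [freeChar, ht, hlam, Complex.cos_add, Complex.cos_sub]
  ring

theorem freeChar_eq_zero_iff {lam : ℂ} : freeChar t lam = 0 ↔ ∃ i, freeRoot t i = lam := by
  have hpi : (Real.pi : ℂ) ≠ 0 := Complex.ofReal_ne_zero.2 Real.pi_ne_zero
  rw [freeChar, sub_eq_zero, mul_right_inj' two_ne_zero, Complex.cos_eq_cos_iff, Sum.exists]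
  have hadd (n : ℤ) : (Real.pi * lam : ℂ) = 2 * n * Real.pi + Real.pi * t ↔
      2 * n + t = lam := by
    rw [← mul_right_inj' hpi (b := 2 * n + t), eq_comm]
    ring_nf
  have hsub (n : ℤ) : (Real.pi * lam : ℂ) = 2 * n * Real.pi - Real.pi * t ↔
      2 * n - t = lam := by
    rw [← mul_right_inj' hpi (b := 2 * n - t), eq_comm]
    ring_nf
  simp only [hadd, hsub, exists_or]
  rfl

theorem two_mul_le_norm_freeRoot_sub (hδ : δ ≤ 1) (ht : ∀ m : ℤ, δ ≤ ‖t - m‖) {i j : ℤ ⊕ ℤ}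
    (hij : i ≠ j) : 2 * δ ≤ ‖freeRoot t i - freeRoot t j‖ := by
  have hint : ∀ n m : ℤ, n ≠ m → 2 * δ ≤ ‖(2 * (n - m : ℤ) : ℂ)‖ := by
    intro n m hnm
    have hone : (1 : ℝ) ≤ ‖((n - m : ℤ) : ℂ)‖ := by
      rw [Complex.norm_intCast]
      exact_mod_cast Int.one_le_abs (sub_ne_zero.2 hnm)
    rw [norm_mul, Complex.norm_two]
    linarith
  have htwo : ∀ n m : ℤ, 2 * δ ≤ ‖2 * (t - (m - n : ℤ))‖ := by
    intro n m
    rw [norm_mul, Complex.norm_two]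
    linarith [ht (m - n)]
  rcases i with n | n <;> rcases j with m | m
  · convert hint n m fun h ↦ hij (congrArg _ h) using 2
    simp [freeRoot]
    ring
  · convert htwo n m using 2
    simp [freeRoot]
    ring
  · convert htwo m n using 1
    rw [← norm_neg]
    congr 1
    simp [freeRoot]
    ring
  · convert hint n m fun h ↦ hij (congrArg _ h) using 2
    simp [freeRoot]
    ring

theorem pi_mul_abs_le (a b : ℝ) :
    Real.pi * |a| ≤ Real.pi / 2 * |a + b| + Real.pi / 2 * |a - b| := by
  have htri : 2 * |a| ≤ |a + b| + |a - b| := by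
    have hsum : 2 * a = (a + b) + (a - b) := by ring
    rw [← abs_two, ← abs_mul, hsum]
    exact abs_add_le _ _
  nlinarith [Real.pi_pos]

theorem exists_mul_exp_le_norm_freeChar (hδ₁ : δ ≤ 1) (ht : ∀ m : ℤ, δ ≤ ‖t - m‖)
    (lam : ℂ) : ∃ i, 4 / 25 * δ * min 1 ‖lam - freeRoot t i‖ * Real.exp (Real.pi * |lam.im|) ≤
      ‖freeChar t lam‖ := by
  obtain ⟨n, hn⟩ := exists_min_one_norm_sub_mul_exp_le_norm_sin (lam + t)
  obtain ⟨m, hm⟩ := exists_min_one_norm_sub_mul_exp_le_norm_sin (lam - t)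
  have hn' : lam + t - 2 * n = lam - freeRoot t (.inr n) := by
    simp only [freeRoot, Sum.elim_inr]
    ring
  have hm' : lam - t - 2 * m = lam - freeRoot t (.inl m) := by
    simp only [freeRoot, Sum.elim_inl]
    ring
  rw [hn'] at hn
  rw [hm'] at hm
  set u := ‖lam - freeRoot t (.inr n)‖
  set v := ‖lam - freeRoot t (.inl m)‖
  have hexp : Real.exp (Real.pi * |lam.im|) ≤
      Real.exp (Real.pi / 2 * |(lam + t).im|) * Real.exp (Real.pi / 2 * |(lam - t).im|) := by
    rw [← Real.exp_add, Real.exp_le_exp]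
    simpa using pi_mul_abs_le lam.im t.im
  have hprod : 4 / 25 * (min 1 u * min 1 v) * Real.exp (Real.pi * |lam.im|) ≤
      ‖freeChar t lam‖ := by
    rw [freeChar_eq_mul_sin, norm_mul, norm_mul, RCLike.norm_ofNat]
    calc _ ≤ 4 / 25 * (min 1 u * min 1 v) * (Real.exp (Real.pi / 2 * |(lam + t).im|) *
          Real.exp (Real.pi / 2 * |(lam - t).im|)) := by gcongr
      _ = 4 * (1 / 5 * min 1 u * Real.exp (Real.pi / 2 * |(lam + t).im|)) *
          (1 / 5 * min 1 v * Real.exp (Real.pi / 2 * |(lam - t).im|)) := by ring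
      _ ≤ _ := by gcongr
  -- The two roots found are `2δ` apart, so one of them has distance at least `δ` from `lam`.
  have hfar : 2 * δ ≤ u + v := by
    have htri := norm_sub_le_norm_sub_add_norm_sub (freeRoot t (.inr n)) lam (freeRoot t (.inl m))
    rw [norm_sub_rev _ lam] at htri
    exact (two_mul_le_norm_freeRoot_sub hδ₁ ht Sum.inr_ne_inl).trans htri
  rcases le_total δ u with h | h
  · refine ⟨.inl m, le_trans ?_ hprod⟩
    rw [mul_assoc (4 / 25)]
    gcongr
    exact le_min hδ₁ h
  · refine ⟨.inr n, le_trans ?_ hprod⟩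
    rw [mul_assoc (4 / 25), mul_comm (min 1 u)]
    gcongr
    exact le_min hδ₁ (by linarith)

theorem freeRoot_injective (ht : ∀ m : ℤ, t ≠ m) : Function.Injective (freeRoot t) := by
  have hne : ∀ n m : ℤ, 2 * n + t ≠ 2 * m - t := fun n m h ↦ ht (m - n) (by
    push_cast
    linear_combination h / 2)
  rintro (n | n) (m | m) h
  · simpa [freeRoot] using h
  · exact absurd h (hne n m)
  · exact absurd h.symm (hne m n)
  · simpa [freeRoot] using h

theorem deriv_freeChar (t lam : ℂ) :
    deriv (freeChar t) lam = 2 * Real.pi * Complex.sin (Real.pi * lam) := by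
  have hpi : HasDerivAt (fun z : ℂ ↦ Real.pi * z) Real.pi lam := by
    simpa using (hasDerivAt_id lam).const_mul (Real.pi : ℂ)
  refine ((hpi.ccos.const_mul 2).const_sub (2 * Complex.cos (Real.pi * t))).deriv.trans ?_
  ring

theorem deriv_freeChar_freeRoot_ne_zero (ht : ∀ m : ℤ, t ≠ m) (i : ℤ ⊕ ℤ) :
    deriv (freeChar t) (freeRoot t i) ≠ 0 := by
  have hpi : (Real.pi : ℂ) ≠ 0 := Complex.ofReal_ne_zero.2 Real.pi_ne_zero
  rw [deriv_freeChar]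
  refine mul_ne_zero (mul_ne_zero two_ne_zero hpi) fun h ↦ ?_
  obtain ⟨k, hk⟩ := Complex.sin_eq_zero_iff.1 h
  rw [mul_comm, mul_left_inj' hpi] at hk
  rcases i with n | n <;> simp only [freeRoot, Sum.elim_inl, Sum.elim_inr] at hk
  · refine ht (k - 2 * n) ?_
    push_cast
    linear_combination hk
  · refine ht (2 * n - k) ?_
    push_cast
    linear_combination -hk

theorem enumeratesZeros_freeChar (ht : ∀ m : ℤ, t ≠ m) :
    EnumeratesZeros (freeChar t) (freeRoot t) := by
  intro w
  have han := (differentiable_freeChar t).analyticAt w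
  by_cases hw : ∃ i, freeRoot t i = w
  · obtain ⟨i, rfl⟩ := hw
    have hsing : {j | freeRoot t j = freeRoot t i} = {i} :=
      Set.ext fun j ↦ (freeRoot_injective ht).eq_iff
    rw [hsing, Set.encard_singleton]
    exact han.analyticOrderAt_eq_one_of_zero_deriv_ne_zero (freeChar_eq_zero_iff.2 ⟨i, rfl⟩)
      (deriv_freeChar_freeRoot_ne_zero ht i)
  · have hempty : {j | freeRoot t j = w} = ∅ := Set.eq_empty_of_forall_notMem fun j hj ↦ hw ⟨j, hj⟩
    rw [hempty, Set.encard_empty, han.analyticOrderAt_eq_zero]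
    exact fun h ↦ hw (freeChar_eq_zero_iff.1 h)

theorem quarter_le_abs_norm_sub {z : ℂ} {k B : ℝ} (hz : |z.im| ≤ B) (hk : 4 * B ^ 2 + 1 ≤ k)
    (hre : 1 / 2 ≤ |(|z.re| - k)|) : 1 / 4 ≤ |‖z‖ - k| := by
  by_contra! hlt
  obtain ⟨hlow, hup⟩ := abs_lt.1 hlt
  have him : z.im ^ 2 ≤ B ^ 2 := by
    rw [← sq_abs z.im]
    gcongr
  have hsq : ‖z‖ ^ 2 = |z.re| ^ 2 + z.im ^ 2 := by
    rw [← Complex.normSq_eq_norm_sq, Complex.normSq_apply, sq_abs]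
    ring
  have hle := Complex.abs_re_le_norm z
  have hclose : ‖z‖ - |z.re| ≤ 1 / 4 := by nlinarith [abs_nonneg z.re]
  rcases le_abs.1 hre with h | h <;> linarith

theorem exists_int_abs_re_freeRoot_sub_le (t : ℂ) (i : ℤ ⊕ ℤ) :
    ∃ m : ℤ, Even (m - round t.re) ∧ |(freeRoot t i).re - m| ≤ 1 / 2 := by
  have hround := abs_sub_round t.re
  rcases i with n | n
  · refine ⟨2 * n + round t.re, ⟨n, by ring⟩, ?_⟩
    simpa [freeRoot] using hround
  · refine ⟨2 * n - round t.re, ⟨n - round t.re, by ring⟩, ?_⟩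
    rw [abs_sub_comm] at hround
    simpa [freeRoot, neg_add_eq_sub] using hround

theorem abs_im_freeRoot (t : ℂ) (i : ℤ ⊕ ℤ) : |(freeRoot t i).im| = |t.im| := by
  rcases i with n | n <;> simp [freeRoot]

theorem exists_radius {B : ℝ} (ht : |t.im| ≤ B) (N : ℕ) (hN : 4 * B ^ 2 + 1 ≤ N) :
    ∃ k : ℝ, N ≤ k ∧ k ≤ N + 1 ∧ ∀ i, 1 / 4 ≤ |‖freeRoot t i‖ - k| := by
  obtain ⟨k, hNk, hkN, hodd⟩ : ∃ k : ℕ, N ≤ k ∧ k ≤ N + 1 ∧ ¬ Even ((k : ℤ) - round t.re) := by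
    by_cases h : Even ((N : ℤ) - round t.re)
    · refine ⟨N + 1, N.le_succ, le_rfl, ?_⟩
      have hsucc : ((N + 1 : ℕ) : ℤ) - round t.re = N - round t.re + 1 := by
        push_cast
        ring
      rw [hsucc, Int.even_add_one]
      exact not_not.2 h
    · exact ⟨N, le_rfl, N.le_succ, h⟩
  refine ⟨k, mod_cast hNk, mod_cast hkN, fun i ↦ ?_⟩
  obtain ⟨m, hm, hre⟩ := exists_int_abs_re_freeRoot_sub_le t i
  refine quarter_le_abs_norm_sub ((abs_im_freeRoot t i).trans_le ht)
    (hN.trans (mod_cast hNk)) ?_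
  have hmk : (1 : ℝ) ≤ |((|m| - k : ℤ) : ℝ)| := by
    refine mod_cast Int.one_le_abs fun h ↦ hodd ?_
    rw [← sub_eq_zero.1 h]
    grind
  push_cast at hmk
  have hdist := (abs_abs_sub_abs_le (freeRoot t i).re (m : ℝ)).trans hre
  have htri := abs_sub_le |(m : ℝ)| |(freeRoot t i).re| k
  rw [abs_sub_comm |(m : ℝ)| |(freeRoot t i).re|] at htri
  linarith

section Perturbation

variable {F : ℂ → ℂ} {C k : ℝ} {lam : ℂ}

theorem norm_sub_freeChar_lt_norm (hδ₀ : 0 < δ) (hδ₁ : δ ≤ 1) (ht : ∀ m : ℤ, δ ≤ ‖t - m‖)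
    (hk : 0 < k) (hCk : C < 2 / 25 * δ ^ 2 * k) (hlam : k ≤ ‖lam‖)
    (hF : ‖F lam - freeChar t lam‖ ≤ C / ‖lam‖ * Real.exp (Real.pi * |lam.im|))
    (hfar : ∀ i, δ / 2 ≤ dist lam (freeRoot t i)) :
    ‖F lam - freeChar t lam‖ < ‖freeChar t lam‖ := by
  obtain ⟨i, hi⟩ := exists_mul_exp_le_norm_freeChar hδ₁ ht lam
  have hlam₀ : 0 < ‖lam‖ := hk.trans_le hlam
  calc ‖F lam - freeChar t lam‖ ≤ C / ‖lam‖ * Real.exp (Real.pi * |lam.im|) := hF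
    _ < 4 / 25 * δ * (δ / 2) * Real.exp (Real.pi * |lam.im|) := by
        gcongr
        rw [div_lt_iff₀ hlam₀]
        nlinarith [sq_pos_of_pos hδ₀]
    _ ≤ 4 / 25 * δ * min 1 ‖lam - freeRoot t i‖ * Real.exp (Real.pi * |lam.im|) := by
        gcongr
        exact le_min (by linarith) (dist_eq_norm lam _ ▸ hfar i)
    _ ≤ ‖freeChar t lam‖ := hi

theorem norm_sub_freeRoot_le_of_eq_zero (hδ₀ : 0 < δ) (hδ₁ : δ ≤ 1) (ht : ∀ m : ℤ, δ ≤ ‖t - m‖)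
    (hk : 0 < k) (hCk : C < 2 / 25 * δ ^ 2 * k) (hlam : k ≤ ‖lam‖)
    (hF : ‖F lam - freeChar t lam‖ ≤ C / ‖lam‖ * Real.exp (Real.pi * |lam.im|))
    (hF₀ : F lam = 0) {i : ℤ ⊕ ℤ} (hi : dist lam (freeRoot t i) < δ / 2) :
    ‖lam - freeRoot t i‖ ≤ 25 / 4 / δ * C / ‖lam‖ := by
  obtain ⟨j, hj⟩ := exists_mul_exp_le_norm_freeChar hδ₁ ht lam
  have hlam₀ : 0 < ‖lam‖ := hk.trans_le hlam
  rw [hF₀, zero_sub, norm_neg] at hF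
  have hmin : 4 / 25 * δ * min 1 ‖lam - freeRoot t j‖ ≤ C / ‖lam‖ :=
    le_of_mul_le_mul_right (hj.trans hF) (Real.exp_pos _)
  have hsmall : C / ‖lam‖ < 4 / 25 * δ * (δ / 2) := by
    rw [div_lt_iff₀ hlam₀]
    nlinarith [sq_pos_of_pos hδ₀]
  have hlt : min 1 ‖lam - freeRoot t j‖ < δ / 2 :=
    lt_of_mul_lt_mul_left (hmin.trans_lt hsmall) (by positivity)
  have hnear : ‖lam - freeRoot t j‖ < δ / 2 :=
    (min_lt_iff.1 hlt).resolve_left (by linarith)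
  obtain rfl : j = i := by
    by_contra hji
    have hsep := two_mul_le_norm_freeRoot_sub hδ₁ ht hji
    rw [← dist_eq_norm] at hsep hnear
    linarith [dist_triangle_left (freeRoot t j) (freeRoot t i) lam]
  rw [min_eq_right (by linarith)] at hmin
  calc ‖lam - freeRoot t j‖ = 25 / 4 / δ * (4 / 25 * δ * ‖lam - freeRoot t j‖) := by field_simp
    _ ≤ 25 / 4 / δ * (C / ‖lam‖) := by gcongr
    _ = 25 / 4 / δ * C / ‖lam‖ := (mul_div_assoc _ _ _).symm

theorem exists_enumeratesZeros_near_freeRoot (hδ₀ : 0 < δ) (hδ₁ : δ ≤ 1 / 2)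
    (ht : ∀ m : ℤ, δ ≤ ‖t - m‖) (hk : 0 < k) (hCk : C < 2 / 25 * δ ^ 2 * k)
    (hgap : ∀ i, 1 / 4 ≤ |‖freeRoot t i‖ - k|) (hFd : Differentiable ℂ F)
    (hF : ∀ lam, k ≤ ‖lam‖ →
      ‖F lam - freeChar t lam‖ ≤ C / ‖lam‖ * Real.exp (Real.pi * |lam.im|)) :
    ∃ z : ℤ ⊕ ℤ → ℂ, EnumeratesZeros F z ∧ ∀ i, k < ‖freeRoot t i‖ →
      dist (z i) (freeRoot t i) < δ / 2 ∧ ‖z i - freeRoot t i‖ ≤ 25 / 4 / δ * C / ‖z i‖ := by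
  have hδ₁' : δ ≤ 1 := by linarith
  have hgap' : ∀ i, δ / 2 ≤ |‖freeRoot t i‖ - k| := fun i ↦ le_trans (by linarith) (hgap i)
  have hne : ∀ m : ℤ, t ≠ m := fun m h ↦ by
    have := ht m
    rw [h, sub_self, norm_zero] at this
    linarith
  have hsep : Pairwise fun i j ↦ δ / 2 + δ / 2 ≤ dist (freeRoot t i) (freeRoot t j) := by
    intro i j hij
    rw [dist_eq_norm]
    linarith [two_mul_le_norm_freeRoot_sub hδ₁' ht hij]
  obtain ⟨z, hz, hnear⟩ := (enumeratesZeros_freeChar hne).exists_near hk (half_pos hδ₀) hFd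
    (differentiable_freeChar t) hsep hgap'
    fun lam hlam ↦ norm_sub_freeChar_lt_norm hδ₀ hδ₁' ht hk hCk hlam (hF lam hlam)
  refine ⟨z, hz, fun i hi ↦ ⟨hnear i hi, ?_⟩⟩
  have hzk : k ≤ ‖z i‖ := by
    have hroot : k + δ / 2 ≤ ‖freeRoot t i‖ := add_le_norm_of_sub_lt_norm hgap' (by linarith)
    linarith [neg_abs_le (‖z i‖ - ‖freeRoot t i‖),
      abs_norm_sub_norm_le_dist (z i) (freeRoot t i), hnear i hi]
  exact norm_sub_freeRoot_le_of_eq_zero hδ₀ hδ₁' ht hk hCk hzk (hF _ hzk) (hz.eq_zero i)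
    (hnear i hi)

theorem two_mul_abs_sub_norm_le_norm_freeRoot (t : ℂ) (i : ℤ ⊕ ℤ) :
    2 * |((Sum.elim id id i : ℤ) : ℝ)| - ‖t‖ ≤ ‖freeRoot t i‖ := by
  have hnorm (n : ℤ) : ‖(2 * n : ℂ)‖ = 2 * |(n : ℝ)| := by
    rw [norm_mul, Complex.norm_two, Complex.norm_intCast]
  rcases i with n | n
  · simpa [freeRoot, hnorm] using norm_sub_norm_le (2 * n : ℂ) (-t)
  · simpa [freeRoot, hnorm] using norm_sub_norm_le (2 * n : ℂ) t

theorem exists_enumeratesZeros_norm_sub_freeRoot_le {B : ℝ} (hδ : 0 < δ) (hC : 0 ≤ C) (k₀ : ℝ) :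
    ∃ (M : ℝ) (N : ℕ), ∀ t : ℂ, ‖t‖ ≤ B → (∀ m : ℤ, δ ≤ ‖t - m‖) → ∀ F : ℂ → ℂ,
      Differentiable ℂ F → (∀ lam, k₀ ≤ ‖lam‖ →
        ‖F lam - freeChar t lam‖ ≤ C / ‖lam‖ * Real.exp (Real.pi * |lam.im|)) →
      ∃ z : ℤ ⊕ ℤ → ℂ, EnumeratesZeros F z ∧ ∀ i, (N : ℤ) < |Sum.elim id id i| →
        ‖z i - freeRoot t i‖ ≤ M / |((Sum.elim id id i : ℤ) : ℝ)| := by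
  wlog hδ₁ : δ ≤ 1 / 2 generalizing δ
  · obtain ⟨M, N, h⟩ := this one_half_pos le_rfl
    exact ⟨M, N, fun t hB ht ↦ h t hB fun m ↦ (not_le.1 hδ₁).le.trans (ht m)⟩
  obtain ⟨N, hN⟩ := exists_nat_ge (max (4 * B ^ 2 + 1) (max k₀ (C / (2 / 25 * δ ^ 2) + 1)))
  obtain ⟨hNB, hN⟩ := max_le_iff.1 hN
  obtain ⟨hNk₀, hNC⟩ := max_le_iff.1 hN
  obtain ⟨N', hN'⟩ := exists_nat_ge (N + 1 + B)
  refine ⟨25 / 4 / δ * C, N', fun t htB ht F hFd hF ↦ ?_⟩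
  obtain ⟨k, hNk, hkN, hgap⟩ := exists_radius ((Complex.abs_im_le_norm t).trans htB) N hNB
  have hCk : C < 2 / 25 * δ ^ 2 * k := by
    rw [← div_lt_iff₀' (by positivity)]
    linarith
  have hk : 0 < k := by nlinarith
  obtain ⟨z, hz, hnear⟩ := exists_enumeratesZeros_near_freeRoot hδ hδ₁ ht hk hCk hgap hFd
    fun lam hlam ↦ hF lam (by linarith)
  refine ⟨z, hz, fun i hi ↦ ?_⟩
  have hiN : (N' : ℝ) < |((Sum.elim id id i : ℤ) : ℝ)| := mod_cast hi
  have hroot := two_mul_abs_sub_norm_le_norm_freeRoot t i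
  have hkB : k < ‖freeRoot t i‖ := by linarith
  obtain ⟨hdist, hle⟩ := hnear i hkB
  have hzi : |((Sum.elim id id i : ℤ) : ℝ)| ≤ ‖z i‖ := by
    linarith [neg_abs_le (‖z i‖ - ‖freeRoot t i‖),
      abs_norm_sub_norm_le_dist (z i) (freeRoot t i)]
  refine hle.trans ?_
  have : 0 < |((Sum.elim id id i : ℤ) : ℝ)| := N'.cast_nonneg.trans_lt hiN
  gcongr

end Perturbation

theorem le_norm_sub_int_of_mem_region {h : ℝ} (hh : h ∈ Set.Ioo (0 : ℝ) (1 / 10))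
    (ht : t ∈ region h) (m : ℤ) : h ≤ ‖t - m‖ := by
  obtain ⟨⟨-, hre_ge, hre_le⟩, hball⟩ := ht
  rw [Set.mem_union, not_or, Metric.mem_ball, Metric.mem_ball, not_lt, not_lt, dist_zero_right,
    dist_eq_norm] at hball
  have hre : |t.re - m| ≤ ‖t - m‖ := by simpa using Complex.abs_re_le_norm (t - m)
  rcases lt_trichotomy m 0 with hm | rfl | hm
  · have : (m : ℝ) ≤ -1 := mod_cast Int.le_sub_one_of_lt hm
    linarith [le_abs_self (t.re - m), hh.2]
  · simpa using hball.1
  · rcases (Int.add_one_le_of_lt hm).eq_or_lt with rfl | hm₂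
    · simpa using hball.2
    · have : (2 : ℝ) ≤ m := mod_cast hm₂
      linarith [neg_abs_le (t.re - m)]

theorem isBounded_region (h : ℝ) : Bornology.IsBounded (region h) := by
  refine (((Metric.isBounded_Icc (-h) (2 - h)).reProdIm
    (Metric.isBounded_Icc (-(2 * h)) (2 * h))).subset ?_)
  rintro t ⟨⟨him, hre⟩, -⟩
  exact Complex.mem_reProdIm.2 ⟨hre, abs_le.1 him⟩

end Dirac

section BoundedVariation

theorem boundedVariationOn_add {α E : Type*} [LinearOrder α] [SeminormedAddCommGroup E]
    {f g : α → E} {s : Set α} (hf : BoundedVariationOn f s) (hg : BoundedVariationOn g s) :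
    BoundedVariationOn (fun x ↦ f x + g x) s := by
  refine ne_top_of_le_ne_top (ENNReal.add_ne_top.2 ⟨hf, hg⟩) (iSup_le fun P ↦ ?_)
  refine (Finset.sum_le_sum fun i _ ↦ edist_add_add_le _ _ _ _).trans ?_
  rw [Finset.sum_add_distrib]
  exact add_le_add
    (le_iSup (fun P : ℕ × { u : ℕ → α // Monotone u ∧ ∀ i, u i ∈ s } ↦
      ∑ i ∈ Finset.range P.1, edist (f (P.2.1 (i + 1))) (f (P.2.1 i))) P)
    (le_iSup (fun P : ℕ × { u : ℕ → α // Monotone u ∧ ∀ i, u i ∈ s } ↦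
      ∑ i ∈ Finset.range P.1, edist (g (P.2.1 (i + 1))) (g (P.2.1 i))) P)

theorem boundedVariationOn_const_mul {α : Type*} [LinearOrder α] {f : α → ℂ} {s : Set α} (c : ℂ)
    (hf : BoundedVariationOn f s) : BoundedVariationOn (fun x ↦ c * f x) s := by
  have hc : BoundedVariationOn (fun _ : α ↦ c) s := by
    rw [BoundedVariationOn, eVariationOn.constant_on
      (Set.subsingleton_singleton.anti (Set.image_subset_iff.2 fun _ _ ↦ Set.mem_singleton c))]
    exact ENNReal.zero_ne_top
  exact hc.smul hf

theorem exists_norm_le_of_boundedVariationOn {α E : Type*} [LinearOrder α]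
    [SeminormedAddCommGroup E] {f : α → E} {s : Set α} (hf : BoundedVariationOn f s) :
    ∃ M, 0 ≤ M ∧ ∀ x ∈ s, ‖f x‖ ≤ M := by
  rcases s.eq_empty_or_nonempty with rfl | ⟨y, hy⟩
  · exact ⟨0, le_rfl, fun _ hx ↦ hx.elim⟩
  refine ⟨‖f y‖ + (eVariationOn f s).toReal, by positivity, fun x hx ↦ ?_⟩
  have hdist := hf.dist_le hx hy
  rw [dist_eq_norm] at hdist
  linarith [norm_sub_norm_le (f x) (f y)]

theorem exists_monotoneOn_sum_of_boundedVariationOn {α : Type*} [LinearOrder α] {p : α → ℂ}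
    {s : Set α} (hp : BoundedVariationOn p s) : ∃ f : Fin 4 → α → ℝ,
      (∀ k, MonotoneOn (f k) s) ∧ ∀ x, p x = ∑ k, f k x • Complex.I ^ (k : ℕ) := by
  have hre := Complex.reCLM.lipschitz.comp_boundedVariationOn hp
  have him := Complex.imCLM.lipschitz.comp_boundedVariationOn hp
  obtain ⟨f₀, f₂, h₀, h₂, hre_eq⟩ :=
    hre.locallyBoundedVariationOn.exists_monotoneOn_sub_monotoneOn
  obtain ⟨f₁, f₃, h₁, h₃, him_eq⟩ :=
    him.locallyBoundedVariationOn.exists_monotoneOn_sub_monotoneOn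
  refine ⟨![f₀, f₁, f₂, f₃], fun | 0 => h₀ | 1 => h₁ | 2 => h₂ | 3 => h₃, fun x ↦ ?_⟩
  have hre_x : (p x).re = f₀ x - f₂ x := congrFun hre_eq x
  have him_x : (p x).im = f₁ x - f₃ x := congrFun him_eq x
  simp [Fin.sum_univ_four, Complex.ext_iff, hre_x, him_x, pow_succ, sub_eq_add_neg]

theorem aestronglyMeasurable_restrict_of_boundedVariationOn {p : ℝ → ℂ} {s : Set ℝ}
    (hs : MeasurableSet s) (hp : BoundedVariationOn p s) :
    AEStronglyMeasurable p (volume.restrict s) := by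
  obtain ⟨f, hf, hpf⟩ := exists_monotoneOn_sum_of_boundedVariationOn hp
  rw [funext hpf]
  exact Finset.aestronglyMeasurable_fun_sum _ fun k _ ↦
    ((aemeasurable_restrict_of_monotoneOn hs (hf k)).aestronglyMeasurable).smul_const _

theorem intervalIntegrable_of_boundedVariationOn {p : ℝ → ℂ} {a b : ℝ} (hab : a ≤ b)
    (hp : BoundedVariationOn p (Set.Icc a b)) : IntervalIntegrable p volume a b := by
  obtain ⟨M, -, hM⟩ := exists_norm_le_of_boundedVariationOn hp
  exact (intervalIntegrable_iff_integrableOn_Icc_of_le hab).2 <|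
    IntegrableOn.of_bound measure_Icc_lt_top
      (aestronglyMeasurable_restrict_of_boundedVariationOn measurableSet_Icc hp)
      M (ae_restrict_of_forall_mem measurableSet_Icc hM)

theorem exists_ae_eq_Ioc_sublevel {f : ℝ → ℝ} {a b : ℝ} (hab : a ≤ b)
    (hf : MonotoneOn f (Set.Ioc a b)) (y : ℝ) :
    ∃ c ∈ Set.Icc a b, (Set.Ioc a b ∩ {x | f x < y} : Set ℝ) =ᵐ[volume] Set.Ioc a c := by
  set S := Set.Ioc a b ∩ {x | f x < y}
  have hSb : b ∈ upperBounds (insert a S) := by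
    rintro x (rfl | hx)
    exacts [hab, hx.1.2]
  set c := sSup (insert a S)
  have hlub : IsLUB (insert a S) c := isLUB_csSup ⟨a, Set.mem_insert _ _⟩ ⟨b, hSb⟩
  refine ⟨c, ⟨hlub.1 (Set.mem_insert _ _), hlub.2 hSb⟩, ?_⟩
  have hsub : S ⊆ Set.Ioc a c := fun x hx ↦ ⟨hx.1.1, hlub.1 (Set.mem_insert_of_mem _ hx)⟩
  have hsup : Set.Ioo a c ⊆ S := by
    intro x hx
    obtain ⟨z, hz | hz, hxz, -⟩ := hlub.exists_between hx.2
    · exact absurd (hz ▸ hxz) hx.1.not_gt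
    · have hxI : x ∈ Set.Ioc a b := ⟨hx.1, hxz.le.trans hz.1.2⟩
      exact ⟨hxI, (hf hxI hz.1 hxz.le).trans_lt hz.2⟩
  exact hsub.eventuallyLE.antisymm (Ioo_ae_eq_Ioc.symm.le.trans hsup.eventuallyLE)

theorem abs_le_max_abs_abs_of_monotoneOn {f : ℝ → ℝ} {a b : ℝ} (hf : MonotoneOn f (Set.Icc a b)) :
    ∀ x ∈ Set.Icc a b, |f x| ≤ max |f a| |f b| := fun _ hx ↦
  have hab : a ≤ b := hx.1.trans hx.2
  abs_le_max_abs_abs (hf (Set.left_mem_Icc.2 hab) hx hx.1) (hf hx (Set.right_mem_Icc.2 hab) hx.2)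

variable {E : Type*} [NormedAddCommGroup E] [NormedSpace ℝ E] {a b : ℝ}

theorem intervalIntegrable_smul_of_monotoneOn {f : ℝ → ℝ} {g : ℝ → E} (hab : a ≤ b)
    (hf : MonotoneOn f (Set.Icc a b)) (hg : IntervalIntegrable g volume a b) :
    IntervalIntegrable (fun s ↦ f s • g s) volume a b := by
  rw [intervalIntegrable_iff_integrableOn_Icc_of_le hab] at hg ⊢
  exact hg.bdd_smul _
    (aemeasurable_restrict_of_monotoneOn measurableSet_Icc hf).aestronglyMeasurable
    (ae_restrict_of_forall_mem measurableSet_Icc (abs_le_max_abs_abs_of_monotoneOn hf))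

variable [CompleteSpace E] {G : ℝ}

/- Layer cake: `f b - f s` is the length of the set of levels `y ∈ (f a, f b]` with `f s < y`, and
each `{f < y}` is an initial segment of `(a, b]`, over which `g` has integral at most `G`. -/
theorem norm_integral_sub_smul_le_of_monotone {f : ℝ → ℝ} (hf : Monotone f) {g : ℝ → E}
    (hab : a ≤ b) (hg : IntervalIntegrable g volume a b)
    (hG : ∀ u ∈ Set.Icc a b, ‖∫ s in a..u, g s‖ ≤ G) :
    ‖∫ s in a..b, (f b - f s) • g s‖ ≤ (f b - f a) * G := by
  have hg' := (intervalIntegrable_iff_integrableOn_Ioc_of_le hab).1 hg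
  set F : ℝ → ℝ → E := fun s y ↦ {z : ℝ × ℝ | f z.1 < z.2}.indicator (fun z ↦ g z.1) (s, y)
  have hF : Integrable (Function.uncurry F)
      ((volume.restrict (Set.Ioc a b)).prod (volume.restrict (Set.Ioc (f a) (f b)))) :=
    (hg'.comp_fst _).indicator
      (measurableSet_lt (hf.measurable.comp measurable_fst) measurable_snd)
  have hinner : ∀ s ∈ Set.Ioc a b, ∫ y in Set.Ioc (f a) (f b), F s y = (f b - f s) • g s := by
    intro s hs
    have hset : Set.Ioi (f s) ∩ Set.Ioc (f a) (f b) = Set.Ioc (f s) (f b) := by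
      ext y
      have := hf hs.1.le
      grind
    calc ∫ y in Set.Ioc (f a) (f b), F s y
        = ∫ y in Set.Ioc (f a) (f b), (Set.Ioi (f s)).indicator (fun _ ↦ g s) y := rfl
      _ = (f b - f s) • g s := by
        rw [integral_indicator measurableSet_Ioi, Measure.restrict_restrict measurableSet_Ioi,
          hset, setIntegral_const, Real.volume_real_Ioc_of_le (hf hs.2)]
  have houter : ∀ y, ‖∫ s in Set.Ioc a b, F s y‖ ≤ G := by
    intro y
    obtain ⟨c, hc, hae⟩ := exists_ae_eq_Ioc_sublevel hab (hf.monotoneOn _) y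
    have hmeas : MeasurableSet {s | f s < y} := measurableSet_lt hf.measurable measurable_const
    calc ‖∫ s in Set.Ioc a b, F s y‖ = ‖∫ s in Set.Ioc a b, {s | f s < y}.indicator g s‖ := rfl
      _ = ‖∫ s in a..c, g s‖ := by
        rw [setIntegral_indicator hmeas, intervalIntegral.integral_of_le hc.1,
          setIntegral_congr_set hae]
      _ ≤ G := hG c hc
  rw [intervalIntegral.integral_of_le hab, ← setIntegral_congr_fun measurableSet_Ioc hinner,
    integral_integral_swap hF]
  refine (norm_setIntegral_le_of_norm_le_const (by simp) fun y _ ↦ houter y).trans ?_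
  rw [Real.volume_real_Ioc_of_le (hf hab), mul_comm]

theorem norm_integral_smul_le_of_monotoneOn {f : ℝ → ℝ} {g : ℝ → E} (hab : a ≤ b)
    (hf : MonotoneOn f (Set.Icc a b)) (hg : IntervalIntegrable g volume a b)
    (hG : ∀ u ∈ Set.Icc a b, ‖∫ s in a..u, g s‖ ≤ G) :
    ‖∫ s in a..b, f s • g s‖ ≤ (|f b| + (f b - f a)) * G := by
  have ha : a ∈ Set.Icc a b := Set.left_mem_Icc.2 hab
  have hb : b ∈ Set.Icc a b := Set.right_mem_Icc.2 hab
  obtain ⟨F, hF, hfF⟩ := hf.exists_monotone_extension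
    (hf.map_bddBelow subset_rfl ⟨a, fun _ hx ↦ hx.1, ha⟩)
    (hf.map_bddAbove subset_rfl ⟨b, fun _ hx ↦ hx.2, hb⟩)
  have hint : ∫ s in a..b, f s • g s = ∫ s in a..b, F s • g s :=
    intervalIntegral.integral_congr fun s hs ↦ by
      simp only [hfF (Set.uIcc_of_le hab ▸ hs)]
  rw [hfF ha, hfF hb, hint]
  calc ‖∫ s in a..b, F s • g s‖
      = ‖F b • (∫ s in a..b, g s) - ∫ s in a..b, (F b - F s) • g s‖ := by
        simp_rw [sub_smul]
        rw [intervalIntegral.integral_sub (hg.continuousOn_smul continuousOn_const)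
          (intervalIntegrable_smul_of_monotoneOn hab (hF.monotoneOn _) hg),
          intervalIntegral.integral_smul, sub_sub_cancel]
    _ ≤ |F b| * G + (F b - F a) * G := by
        refine (norm_sub_le _ _).trans (add_le_add ?_
          (norm_integral_sub_smul_le_of_monotone hF hab hg hG))
        rw [norm_smul, Real.norm_eq_abs]
        exact mul_le_mul_of_nonneg_left (hG b hb) (abs_nonneg _)
    _ = (|F b| + (F b - F a)) * G := by ring

theorem exists_norm_integral_mul_le_of_boundedVariationOn {p : ℝ → ℂ}
    (hp : BoundedVariationOn p (Set.Icc a b)) : ∃ C, 0 ≤ C ∧ ∀ r x, a ≤ r → r ≤ x → x ≤ b →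
      ∀ g : ℝ → ℂ, IntervalIntegrable g volume r x →
        ∀ G, (∀ u ∈ Set.Icc r x, ‖∫ s in r..u, g s‖ ≤ G) → ‖∫ s in r..x, p s * g s‖ ≤ C * G := by
  obtain ⟨f, hf, hpf⟩ := exists_monotoneOn_sum_of_boundedVariationOn hp
  choose m hm hfm using fun k ↦ exists_norm_le_of_boundedVariationOn
    ((hf k).boundedVariationOn (abs_le_max_abs_abs_of_monotoneOn (hf k)))
  refine ⟨∑ k, 3 * m k, Finset.sum_nonneg fun k _ ↦ mul_nonneg zero_le_three (hm k), ?_⟩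
  intro r x har hrx hxb g hg G hG
  have hsub : Set.Icc r x ⊆ Set.Icc a b := Set.Icc_subset_Icc har hxb
  have hint : ∀ k, IntervalIntegrable (fun s ↦ (f k s • g s) * Complex.I ^ (k : ℕ)) volume r x :=
    fun k ↦ (intervalIntegrable_smul_of_monotoneOn hrx ((hf k).mono hsub) hg).mul_const _
  have hbound : ∀ k, ‖∫ s in r..x, (f k s • g s) * Complex.I ^ (k : ℕ)‖ ≤ 3 * m k * G := by
    intro k
    have hr := hfm k r ⟨har, hrx.trans hxb⟩
    have hx := hfm k x ⟨har.trans hrx, hxb⟩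
    have hG₀ : 0 ≤ G := (norm_nonneg _).trans (hG r (Set.left_mem_Icc.2 hrx))
    rw [intervalIntegral.integral_mul_const, norm_mul, norm_pow, Complex.norm_I, one_pow, mul_one]
    refine (norm_integral_smul_le_of_monotoneOn hrx ((hf k).mono hsub) hg hG).trans ?_
    rw [Real.norm_eq_abs] at hr hx
    gcongr
    linarith [le_abs_self (f k x), neg_abs_le (f k r)]
  have hsum : ∀ s, p s * g s = ∑ k, (f k s • g s) * Complex.I ^ (k : ℕ) := fun s ↦ by
    rw [hpf, Finset.sum_mul]
    exact Finset.sum_congr rfl fun k _ ↦ by simp only [Complex.real_smul]; ring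
  simp_rw [hsum]
  rw [intervalIntegral.integral_finsetSum fun k _ ↦ hint k, Finset.sum_mul]
  exact norm_sum_le_of_le _ fun k _ ↦ hbound k

theorem exists_norm_integral_mul_exp_le_of_boundedVariationOn {p : ℝ → ℂ}
    (hp : BoundedVariationOn p (Set.Icc a b)) : ∃ C, 0 ≤ C ∧ ∀ r x, a ≤ r → r ≤ x → x ≤ b →
      ∀ κ : ℂ, κ ≠ 0 → ∀ M, (∀ u ∈ Set.Icc r x, ‖Complex.exp (κ * u)‖ ≤ M) →
        ‖∫ s in r..x, p s * Complex.exp (κ * s)‖ ≤ C * M / ‖κ‖ := by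
  obtain ⟨C, hC, h⟩ := exists_norm_integral_mul_le_of_boundedVariationOn hp
  refine ⟨2 * C, by positivity, fun r x har hrx hxb κ hκ M hM ↦ ?_⟩
  have hexp : ∀ u ∈ Set.Icc r x, ‖∫ s in r..u, Complex.exp (κ * s)‖ ≤ 2 * M / ‖κ‖ := by
    intro u hu
    rw [integral_exp_mul_complex hκ, norm_div]
    gcongr
    linarith [norm_sub_le (Complex.exp (κ * u)) (Complex.exp (κ * r)), hM u hu,
      hM r (Set.left_mem_Icc.2 hrx)]
  have hcont : Continuous fun s : ℝ ↦ Complex.exp (κ * s) := by fun_prop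
  calc ‖∫ s in r..x, p s * Complex.exp (κ * s)‖
      ≤ C * (2 * M / ‖κ‖) := h r x har hrx hxb _ (hcont.intervalIntegrable r x) _ hexp
    _ = 2 * C * M / ‖κ‖ := by ring

end BoundedVariation

open scoped BoundedContinuousFunction

theorem integrable_indicator_Icc_const (T C : ℝ) :
    Integrable ((Set.Icc 0 T).indicator fun _ ↦ C) :=
  (integrable_indicator_iff measurableSet_Icc).2 (integrableOn_const measure_Icc_lt_top.ne)

theorem integral_mul_pow_div_factorial (C D : ℝ) (n : ℕ) (x : ℝ) :
    ∫ s in (0 : ℝ)..x, C * ((C * s) ^ n / n.factorial * D) =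
      (C * x) ^ (n + 1) / (n + 1).factorial * D := by
  have hmonomial : ∀ s : ℝ, C * ((C * s) ^ n / n.factorial * D) =
      (C ^ (n + 1) / n.factorial * D) * s ^ n := fun s ↦ by ring
  simp_rw [hmonomial]
  rw [intervalIntegral.integral_const_mul, integral_pow, zero_pow (Nat.succ_ne_zero n), sub_zero,
    Nat.factorial_succ]
  push_cast
  field_simp
  ring

/-- `A` is an admissible coefficient of a Volterra integral equation on `[0, T]`: a bounded
measurable operator-valued function, extended by zero so that the integral operator acts on
functions on the whole line. -/
structure IsVolterraCoeff {E : Type*} [NormedAddCommGroup E] [NormedSpace ℂ E] (T : ℝ)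
    (A : ℝ → E →L[ℂ] E) : Prop where
  aestronglyMeasurable : AEStronglyMeasurable A volume
  exists_norm_le : ∃ C, 0 ≤ C ∧ ∀ s, ‖A s‖ ≤ C
  eq_zero : ∀ s, s ∉ Set.Icc 0 T → A s = 0

namespace IsVolterraCoeff

variable {E : Type*} [NormedAddCommGroup E] [NormedSpace ℂ E] {T C : ℝ} {A B : ℝ → E →L[ℂ] E}

theorem add (hA : IsVolterraCoeff T A) (hB : IsVolterraCoeff T B) :
    IsVolterraCoeff T (fun s ↦ A s + B s) := by
  refine ⟨hA.1.add hB.1, ?_, fun s hs ↦ by rw [hA.3 s hs, hB.3 s hs, add_zero]⟩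
  obtain ⟨C, hC0, hC⟩ := hA.exists_norm_le
  obtain ⟨D, hD0, hD⟩ := hB.exists_norm_le
  exact ⟨C + D, add_nonneg hC0 hD0, fun s ↦ norm_add_le_of_le (hC s) (hD s)⟩

theorem const_smul (hA : IsVolterraCoeff T A) (c : ℂ) : IsVolterraCoeff T (fun s ↦ c • A s) := by
  refine ⟨hA.1.const_smul c, ?_, fun s hs ↦ by rw [hA.3 s hs, smul_zero]⟩
  obtain ⟨C, hC0, hC⟩ := hA.exists_norm_le
  refine ⟨‖c‖ * C, by positivity, fun s ↦ ?_⟩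
  rw [norm_smul]
  exact mul_le_mul_of_nonneg_left (hC s) (norm_nonneg c)

theorem norm_apply_le_indicator (hA : IsVolterraCoeff T A) (hC : ∀ s, ‖A s‖ ≤ C) (y : ℝ →ᵇ E)
    (s : ℝ) : ‖A s (y s)‖ ≤ (Set.Icc 0 T).indicator (fun _ ↦ C * ‖y‖) s := by
  by_cases hs : s ∈ Set.Icc 0 T
  · rw [Set.indicator_of_mem hs]
    exact (A s).le_of_opNorm_le_of_le (hC s) (y.norm_coe_le_norm s)
  · rw [hA.eq_zero s hs, Set.indicator_of_notMem hs, zero_apply, norm_zero]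

theorem integrable (hA : IsVolterraCoeff T A) (y : ℝ →ᵇ E) :
    Integrable (fun s ↦ A s (y s)) := by
  obtain ⟨C, -, hC⟩ := hA.exists_norm_le
  exact (integrable_indicator_Icc_const T (C * ‖y‖)).mono'
    ((ContinuousLinearMap.apply ℂ E : E →L[ℂ] (E →L[ℂ] E) →L[ℂ] E).aestronglyMeasurable_comp₂
      y.continuous.aestronglyMeasurable hA.aestronglyMeasurable)
    (.of_forall (hA.norm_apply_le_indicator hC y))

theorem norm_integral_le (hA : IsVolterraCoeff T A) (hT : 0 ≤ T)
    (hC : ∀ s, ‖A s‖ ≤ C) (y : ℝ →ᵇ E) (x : ℝ) :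
    ‖∫ s in (0 : ℝ)..x, A s (y s)‖ ≤ C * T * ‖y‖ :=
  calc ‖∫ s in (0 : ℝ)..x, A s (y s)‖
      ≤ ∫ s in Set.uIoc 0 x, ‖A s (y s)‖ := intervalIntegral.norm_integral_le_integral_norm_uIoc
    _ ≤ ∫ s, ‖A s (y s)‖ :=
        setIntegral_le_integral (hA.integrable y).norm (.of_forall fun s ↦ norm_nonneg _)
    _ ≤ ∫ s, (Set.Icc 0 T).indicator (fun _ ↦ C * ‖y‖) s :=
        integral_mono (hA.integrable y).norm (integrable_indicator_Icc_const T _)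
          (hA.norm_apply_le_indicator hC y)
    _ = C * T * ‖y‖ := by
        rw [integral_indicator measurableSet_Icc, setIntegral_const, Real.volume_real_Icc_of_le hT,
          smul_eq_mul, sub_zero]
        ring

/-- The Volterra operator `y ↦ ∫₀ˣ A(s) y(s) ds` on bounded continuous functions on the line. -/
noncomputable def volterra (hA : IsVolterraCoeff T A) (hT : 0 ≤ T) : (ℝ →ᵇ E) →L[ℂ] (ℝ →ᵇ E) :=
  LinearMap.mkContinuousOfExistsBound
    { toFun := fun y ↦ BoundedContinuousFunction.ofNormedAddCommGroup
        (fun x ↦ ∫ s in (0 : ℝ)..x, A s (y s))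
        (intervalIntegral.continuous_primitive (fun _ _ ↦ (hA.integrable y).intervalIntegrable) 0)
        (hA.exists_norm_le.choose * T * ‖y‖)
        (hA.norm_integral_le hT hA.exists_norm_le.choose_spec.2 y)
      map_add' := fun y z ↦ by
        ext1 x
        change ∫ s in (0 : ℝ)..x, A s ((y + z) s) = (∫ s in (0 : ℝ)..x, A s (y s)) +
          ∫ s in (0 : ℝ)..x, A s (z s)
        rw [← intervalIntegral.integral_add (hA.integrable y).intervalIntegrable
          (hA.integrable z).intervalIntegrable]
        simp only [BoundedContinuousFunction.coe_add, Pi.add_apply, map_add]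
      map_smul' := fun c y ↦ by
        ext1 x
        change ∫ s in (0 : ℝ)..x, A s ((c • y) s) = c • ∫ s in (0 : ℝ)..x, A s (y s)
        rw [← intervalIntegral.integral_smul]
        simp only [BoundedContinuousFunction.coe_smul, map_smul] }
    ⟨hA.exists_norm_le.choose * T, fun y ↦
      BoundedContinuousFunction.norm_ofNormedAddCommGroup_le _
        (mul_nonneg (mul_nonneg hA.exists_norm_le.choose_spec.1 hT) (norm_nonneg _))
        (hA.norm_integral_le hT hA.exists_norm_le.choose_spec.2 y)⟩

theorem volterra_apply (hA : IsVolterraCoeff T A) (hT : 0 ≤ T) (y : ℝ →ᵇ E) (x : ℝ) :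
    hA.volterra hT y x = ∫ s in (0 : ℝ)..x, A s (y s) := rfl

theorem volterra_add (hA : IsVolterraCoeff T A) (hB : IsVolterraCoeff T B) (hT : 0 ≤ T) :
    (hA.add hB).volterra hT = hA.volterra hT + hB.volterra hT := by
  ext1 y
  ext1 x
  exact intervalIntegral.integral_add (hA.integrable y).intervalIntegrable
    (hB.integrable y).intervalIntegrable

theorem volterra_const_smul (hA : IsVolterraCoeff T A) (c : ℂ) (hT : 0 ≤ T) :
    (hA.const_smul c).volterra hT = c • hA.volterra hT := by
  ext1 y
  ext1 x
  exact intervalIntegral.integral_smul c _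

theorem volterra_apply_of_nonpos (hA : IsVolterraCoeff T A) (hT : 0 ≤ T) (y : ℝ →ᵇ E) {x : ℝ}
    (hx : x ≤ 0) : hA.volterra hT y x = 0 := by
  refine intervalIntegral.integral_zero_ae ?_
  filter_upwards [compl_mem_ae_iff.2 (measure_singleton (0 : ℝ))] with s hs0 hs
  rw [Set.uIoc_of_ge hx] at hs
  rw [hA.eq_zero s fun h ↦ hs0 (le_antisymm hs.2 h.1), zero_apply]

theorem volterra_apply_of_le (hA : IsVolterraCoeff T A) (hT : 0 ≤ T) (y : ℝ →ᵇ E) {x : ℝ}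
    (hx : T ≤ x) : hA.volterra hT y x = hA.volterra hT y T := by
  rw [volterra_apply, volterra_apply, ← intervalIntegral.integral_add_adjacent_intervals
    (hA.integrable y).intervalIntegrable (hA.integrable y).intervalIntegrable (b := T),
    add_eq_left]
  refine intervalIntegral.integral_zero_ae (.of_forall fun s hs ↦ ?_)
  rw [Set.uIoc_of_le hx] at hs
  rw [hA.eq_zero s fun h ↦ h.2.not_gt hs.1, zero_apply]

theorem norm_volterra_pow_apply_le (hA : IsVolterraCoeff T A) (hT : 0 ≤ T)
    (hC : ∀ s, ‖A s‖ ≤ C) (y : ℝ →ᵇ E) (n : ℕ) :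
    ∀ x, 0 ≤ x → ‖(hA.volterra hT ^ n) y x‖ ≤ (C * x) ^ n / n.factorial * ‖y‖ := by
  induction n with
  | zero => intro x _; simpa using y.norm_coe_le_norm x
  | succ n ih =>
    intro x hx
    rw [pow_succ', mul_apply_eq_comp, volterra_apply, ← integral_mul_pow_div_factorial]
    refine intervalIntegral.norm_integral_le_of_norm_le hx (.of_forall fun s hs ↦ ?_)
      (Continuous.intervalIntegrable (by fun_prop) 0 x)
    exact (A s).le_of_opNorm_le_of_le (hC s) (ih s hs.1.le)

theorem norm_volterra_pow_le (hA : IsVolterraCoeff T A) (hT : 0 ≤ T) (hC0 : 0 ≤ C)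
    (hC : ∀ s, ‖A s‖ ≤ C) {n : ℕ} (hn : n ≠ 0) :
    ‖hA.volterra hT ^ n‖ ≤ (C * T) ^ n / n.factorial := by
  refine ContinuousLinearMap.opNorm_le_bound _ (by positivity) fun y ↦
    (BoundedContinuousFunction.norm_le (by positivity)).2 fun x ↦ ?_
  have hle := hA.norm_volterra_pow_apply_le hT hC y n
  obtain ⟨m, rfl⟩ := Nat.exists_eq_succ_of_ne_zero hn
  rcases le_total x 0 with hx | hx
  · rw [pow_succ', mul_apply_eq_comp, hA.volterra_apply_of_nonpos hT _ hx, norm_zero]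
    positivity
  rcases le_total x T with hxT | hTx
  · refine (hle x hx).trans ?_
    gcongr
  · have hleT := hle T hT
    rw [pow_succ', mul_apply_eq_comp] at hleT ⊢
    rwa [hA.volterra_apply_of_le hT _ hTx]

theorem isUnit_one_sub_volterra [CompleteSpace E] (hA : IsVolterraCoeff T A) (hT : 0 ≤ T) :
    IsUnit (1 - hA.volterra hT) := by
  obtain ⟨C, hC0, hC⟩ := hA.exists_norm_le
  obtain ⟨n, hn_lt, hn⟩ :=
    (((FloorSemiring.tendsto_pow_div_factorial_atTop (C * T)).eventually_lt_const one_pos).and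
      (Filter.eventually_ne_atTop 0)).exists
  have hunit : IsUnit (1 - hA.volterra hT ^ n) :=
    isUnit_one_sub_of_norm_lt_one ((hA.norm_volterra_pow_le hT hC0 hC hn).trans_lt hn_lt)
  rw [← mul_neg_geom_sum] at hunit
  refine ((Commute.isUnit_mul_iff ?_).1 hunit).1
  exact (Commute.one_left _).sub_left (Commute.sum_right _ _ _ fun i _ ↦ Commute.self_pow _ i)

end IsVolterraCoeff

section AbsolutelyContinuous

variable {E : Type*} [NormedAddCommGroup E] [NormedSpace ℝ E] {a b : ℝ}

theorem absolutelyContinuousOnInterval_of_dist_le {X Y : Type*} [PseudoMetricSpace X]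
    [PseudoMetricSpace Y] {f : ℝ → X} {g : ℝ → Y} (hg : AbsolutelyContinuousOnInterval g a b)
    (h : ∀ x ∈ Set.uIcc a b, ∀ y ∈ Set.uIcc a b, dist (f x) (f y) ≤ dist (g x) (g y)) :
    AbsolutelyContinuousOnInterval f a b := by
  rw [absolutelyContinuousOnInterval_iff] at hg ⊢
  intro ε hε
  obtain ⟨δ, hδ, hgδ⟩ := hg ε hε
  refine ⟨δ, hδ, fun I hI hlen ↦ (Finset.sum_le_sum fun i hi ↦ ?_).trans_lt (hgδ I hI hlen)⟩
  exact h _ (hI.1 i hi).1 _ (hI.1 i hi).2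

/-- `u` is an indefinite integral of `f` on the interval with end points `a` and `b`. -/
structure IsPrimitiveOn (u f : ℝ → E) (a b : ℝ) : Prop where
  intervalIntegrable : IntervalIntegrable f volume a b
  eq_add_integral : ∀ x ∈ Set.uIcc a b, u x = u a + ∫ s in a..x, f s

namespace IsPrimitiveOn

variable {u f : ℝ → E}

theorem sub_eq_integral (h : IsPrimitiveOn u f a b) {x y : ℝ} (hx : x ∈ Set.uIcc a b)
    (hy : y ∈ Set.uIcc a b) : u y - u x = ∫ s in x..y, f s := by
  have hint : ∀ z ∈ Set.uIcc a b, IntervalIntegrable f volume a z := fun z hz ↦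
    h.intervalIntegrable.mono_set (Set.uIcc_subset_uIcc_left hz)
  rw [h.eq_add_integral x hx, h.eq_add_integral y hy, add_sub_add_left_eq_sub,
    intervalIntegral.integral_interval_sub_left (hint y hy) (hint x hx)]

theorem absolutelyContinuousOnInterval (h : IsPrimitiveOn u f a b) :
    AbsolutelyContinuousOnInterval u a b := by
  refine absolutelyContinuousOnInterval_of_dist_le
    (h.intervalIntegrable.norm.absolutelyContinuousOnInterval_intervalIntegral
      Set.left_mem_uIcc) fun x hx y hy ↦ ?_
  have hint : ∀ z ∈ Set.uIcc a b, IntervalIntegrable (‖f ·‖) volume a z := fun z hz ↦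
    h.intervalIntegrable.norm.mono_set (Set.uIcc_subset_uIcc_left hz)
  rw [dist_eq_norm, dist_eq_norm, h.sub_eq_integral hy hx,
    intervalIntegral.integral_interval_sub_left (hint x hx) (hint y hy)]
  exact intervalIntegral.norm_integral_le_abs_integral_norm

theorem continuousOn (h : IsPrimitiveOn u f a b) : ContinuousOn u (Set.uIcc a b) :=
  h.absolutelyContinuousOnInterval.continuousOn

theorem mono (h : IsPrimitiveOn u f a b) {c : ℝ} (hc : c ∈ Set.uIcc a b) :
    IsPrimitiveOn u f a c :=
  ⟨h.intervalIntegrable.mono_set (Set.uIcc_subset_uIcc_left hc),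
    fun x hx ↦ h.eq_add_integral x (Set.uIcc_subset_uIcc_left hc hx)⟩

theorem congr (h : IsPrimitiveOn u f a b) {g : ℝ → E} (hfg : Set.EqOn f g (Set.uIcc a b)) :
    IsPrimitiveOn u g a b := by
  refine ⟨h.intervalIntegrable.congr fun x hx ↦ hfg (Set.uIoc_subset_uIcc hx),
    fun x hx ↦ ?_⟩
  rw [h.eq_add_integral x hx, intervalIntegral.integral_congr
    (hfg.mono (Set.uIcc_subset_uIcc_left hx))]

theorem clm_comp {𝕜 F : Type*} [RCLike 𝕜] [NormedSpace 𝕜 E] [NormedAddCommGroup F]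
    [NormedSpace ℝ F] [NormedSpace 𝕜 F] [CompleteSpace E] [CompleteSpace F]
    (h : IsPrimitiveOn u f a b) (L : E →L[𝕜] F) :
    IsPrimitiveOn (fun x ↦ L (u x)) (fun x ↦ L (f x)) a b := by
  refine ⟨⟨L.integrable_comp h.intervalIntegrable.1, L.integrable_comp h.intervalIntegrable.2⟩,
    fun x hx ↦ ?_⟩
  rw [L.intervalIntegral_comp_comm (h.mono hx).intervalIntegrable, h.eq_add_integral x hx, map_add]

variable [CompleteSpace E]

theorem ae_hasDerivAt (h : IsPrimitiveOn u f a b) :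
    ∀ᵐ x, x ∈ Set.uIcc a b → HasDerivAt u (f x) x := by
  have hendpoints : ∀ᵐ x : ℝ, x ∉ ({a, b} : Set ℝ) :=
    compl_mem_ae_iff.2 (Set.Finite.measure_zero (Set.toFinite _) volume)
  filter_upwards [h.intervalIntegrable.ae_hasDerivAt_integral, hendpoints] with x hd hxab hx
  refine ((hd hx a Set.left_mem_uIcc).const_add (u a)).congr_of_eventuallyEq ?_
  have hnhds : Set.uIcc a b ∈ nhds x := by
    rw [Set.mem_insert_iff, Set.mem_singleton_iff] at hxab
    refine Icc_mem_nhds (lt_of_le_of_ne hx.1 fun h0 ↦ ?_) (lt_of_le_of_ne hx.2 fun h0 ↦ ?_) <;>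
      grind
  filter_upwards [hnhds] with y hy using h.eq_add_integral y hy

theorem of_ae_hasDerivAt (hu : AbsolutelyContinuousOnInterval u a b)
    (hf : IntervalIntegrable f volume a b)
    (hd : ∀ᵐ x, x ∈ Set.uIcc a b → HasDerivAt u (f x) x) : IsPrimitiveOn u f a b := by
  have hF : IsPrimitiveOn (fun x ↦ ∫ s in a..x, f s) f a b := ⟨hf, fun x _ ↦ by simp⟩
  obtain ⟨c, hc⟩ := (hu.sub hF.absolutelyContinuousOnInterval).const_of_ae_hasDerivAt_zero (by
    filter_upwards [hd, hF.ae_hasDerivAt] with x hux hFx hx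
    simpa only [sub_self] using (hux hx).sub (hFx hx))
  refine ⟨hf, fun x hx ↦ ?_⟩
  have hxa := (hc x hx).trans (hc a Set.left_mem_uIcc).symm
  rw [Pi.sub_apply, Pi.sub_apply, intervalIntegral.integral_same, sub_zero] at hxa
  exact sub_eq_iff_eq_add.1 hxa

end IsPrimitiveOn

theorem isPrimitiveOn_integral_left {f : ℝ → E} (hf : IntervalIntegrable f volume a b) :
    IsPrimitiveOn (fun x ↦ ∫ s in x..b, f s) (fun x ↦ -f x) a b := by
  refine ⟨hf.neg, fun x hx ↦ ?_⟩
  rw [intervalIntegral.integral_neg, ← sub_eq_add_neg, intervalIntegral.integral_interval_sub_left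
    hf (hf.mono_set (Set.uIcc_subset_uIcc_left hx))]

theorem isPrimitiveOn_exp_mul (κ : ℂ) (a b : ℝ) :
    IsPrimitiveOn (fun x : ℝ ↦ Complex.exp (κ * x)) (fun x ↦ κ * Complex.exp (κ * x)) a b := by
  have hderiv : ∀ x : ℝ, HasDerivAt (fun x : ℝ ↦ Complex.exp (κ * x)) (κ * Complex.exp (κ * x)) x :=
    fun x ↦ by
      simpa [mul_comm] using (((hasDerivAt_id (x : ℂ)).const_mul κ).cexp).comp_ofReal
  have hint : ∀ c, IntervalIntegrable (fun x : ℝ ↦ κ * Complex.exp (κ * x)) volume a c :=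
    fun c ↦ Continuous.intervalIntegrable (by fun_prop) a c
  refine ⟨hint b, fun x _ ↦ ?_⟩
  rw [intervalIntegral.integral_eq_sub_of_hasDerivAt (fun y _ ↦ hderiv y) (hint x), add_sub_cancel]

theorem IsPrimitiveOn.mul {u v f g : ℝ → ℂ} (hu : IsPrimitiveOn u f a b)
    (hv : IsPrimitiveOn v g a b) :
    IsPrimitiveOn (fun x ↦ u x * v x) (fun x ↦ f x * v x + u x * g x) a b := by
  refine .of_ae_hasDerivAt
    (hu.absolutelyContinuousOnInterval.smul hv.absolutelyContinuousOnInterval)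
    ((hu.intervalIntegrable.mul_continuousOn hv.continuousOn).add
      (hv.intervalIntegrable.continuousOn_mul hu.continuousOn)) ?_
  filter_upwards [hu.ae_hasDerivAt, hv.ae_hasDerivAt] with x hux hvx hx
  exact (hux hx).mul (hvx hx)

theorem integral_mul_integral_eq {f g : ℝ → ℂ} (hf : IntervalIntegrable f volume a b)
    (hg : IntervalIntegrable g volume a b) :
    ∫ s in a..b, f s * ∫ r in a..s, g r = ∫ r in a..b, g r * ∫ s in r..b, f s := by
  have hF := isPrimitiveOn_integral_left hf
  have hG : IsPrimitiveOn (fun x ↦ ∫ r in a..x, g r) g a b := ⟨hg, fun x _ ↦ by simp⟩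
  have hparts := (hF.mul hG).eq_add_integral b Set.right_mem_uIcc
  rw [intervalIntegral.integral_add (hF.intervalIntegrable.mul_continuousOn hG.continuousOn)
    (hg.continuousOn_mul hF.continuousOn)] at hparts
  simp only [intervalIntegral.integral_same, zero_mul, mul_zero, zero_add, neg_mul,
    intervalIntegral.integral_neg] at hparts
  simp_rw [mul_comm (g _)]
  linear_combination hparts

end AbsolutelyContinuous

section CanonicalSystem

theorem IsPrimitiveOn.exp_neg_mul {u f : ℝ → ℂ} {κ : ℂ} {a b : ℝ}
    (hu : IsPrimitiveOn u (fun s ↦ κ * u s + f s) a b) :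
    IsPrimitiveOn (fun x ↦ Complex.exp (-κ * x) * u x) (fun x ↦ Complex.exp (-κ * x) * f x) a b :=
  ((isPrimitiveOn_exp_mul (-κ) a b).mul hu).congr fun x _ ↦ by ring

variable {T : ℝ} {a b : ℝ → ℂ}

theorem sub_exp_eq_integral_of_canonical_system {u v : ℝ → ℂ} {lam : ℂ}
    (ha : IntervalIntegrable a volume 0 T) (hb : IntervalIntegrable b volume 0 T)
    (hu : IsPrimitiveOn u (fun s ↦ Complex.I * lam * u s + a s * v s) 0 T) (hu0 : u 0 = 1)
    (hv : IsPrimitiveOn v (fun s ↦ -(Complex.I * lam) * v s + b s * u s) 0 T) (hv0 : v 0 = 0)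
    {x : ℝ} (hx : x ∈ Set.uIcc 0 T) :
    u x - Complex.exp (Complex.I * lam * x) =
      ∫ r in (0 : ℝ)..x, Complex.exp (Complex.I * lam * x) * Complex.exp (Complex.I * lam * r) *
        (∫ s in r..x, a s * Complex.exp (-2 * (Complex.I * lam) * s)) * (b r * u r) := by
  set κ := Complex.I * lam
  have hsub : Set.uIcc 0 x ⊆ Set.uIcc 0 T := Set.uIcc_subset_uIcc_left hx
  have hv_eq : ∀ s ∈ Set.uIcc 0 x, v s =
      Complex.exp (-κ * s) * ∫ r in (0 : ℝ)..s, Complex.exp (κ * r) * (b r * u r) := by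
    intro s hs
    have h := hv.exp_neg_mul.eq_add_integral s (hsub hs)
    simp only [hv0, mul_zero, zero_add, neg_neg] at h
    rw [← h, ← mul_assoc, ← Complex.exp_add, neg_mul, neg_add_cancel, Complex.exp_zero, one_mul]
  have hu_eq : Complex.exp (-κ * x) * u x = 1 +
      ∫ s in (0 : ℝ)..x, a s * Complex.exp (-2 * κ * s) *
        ∫ r in (0 : ℝ)..s, Complex.exp (κ * r) * (b r * u r) := by
    have h := hu.exp_neg_mul.eq_add_integral x hx
    simp only [hu0, mul_one, Complex.ofReal_zero, mul_zero, Complex.exp_zero] at h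
    rw [h]
    congr 1
    refine intervalIntegral.integral_congr fun s hs ↦ ?_
    rw [hv_eq s hs, show -2 * κ * s = -κ * s + -κ * s by ring, Complex.exp_add]
    ring
  rw [integral_mul_integral_eq ((ha.mono_set hsub).mul_continuousOn (by fun_prop))
    (((hb.mono_set hsub).mul_continuousOn (hu.continuousOn.mono hsub)).continuousOn_mul
      (by fun_prop))] at hu_eq
  have hu_x : u x = Complex.exp (κ * x) * (Complex.exp (-κ * x) * u x) := by
    rw [← mul_assoc, ← Complex.exp_add, neg_mul, add_neg_cancel, Complex.exp_zero, one_mul]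
  rw [hu_x, hu_eq, mul_add, mul_one, add_sub_cancel_left, ← intervalIntegral.integral_const_mul]
  refine intervalIntegral.integral_congr fun r _ ↦ ?_
  ring

theorem norm_exp_I_mul_mul_ofReal (lam : ℂ) (x : ℝ) :
    ‖Complex.exp (Complex.I * lam * x)‖ = Real.exp (-(lam.im * x)) := by
  simp [Complex.norm_exp]

theorem exists_norm_exp_mul_exp_mul_integral_le (ha : BoundedVariationOn a (Set.Icc 0 T)) :
    ∃ C, 0 ≤ C ∧ ∀ lam : ℂ, lam ≠ 0 → ∀ r x, 0 ≤ r → r ≤ x → x ≤ T →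
      ‖Complex.exp (Complex.I * lam * x) * Complex.exp (Complex.I * lam * r) *
        ∫ s in r..x, a s * Complex.exp (-2 * (Complex.I * lam) * s)‖ ≤
      C / ‖lam‖ * Real.exp (|lam.im| * (x - r)) := by
  obtain ⟨C, hC0, hC⟩ := exists_norm_integral_mul_exp_le_of_boundedVariationOn ha
  refine ⟨C / 2, by positivity, fun lam hlam r x hr hrx hxT ↦ ?_⟩
  have hκ : -2 * (Complex.I * lam) ≠ 0 := by simp [hlam]
  have hκ_norm : ‖-2 * (Complex.I * lam)‖ = 2 * ‖lam‖ := by simp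
  have hexp : ∀ y ∈ Set.Icc r x, ‖Complex.exp (-2 * (Complex.I * lam) * y)‖ ≤
      Real.exp (|lam.im| * (x - r) + lam.im * (x + r)) := by
    intro y hy
    rw [show -2 * (Complex.I * lam) * (y : ℂ) = Complex.I * lam * ((-2 * y : ℝ) : ℂ) by
      push_cast; ring, norm_exp_I_mul_mul_ofReal, Real.exp_le_exp]
    have hle : lam.im * (2 * y - x - r) ≤ |lam.im| * (x - r) := by
      refine (le_abs_self _).trans ?_
      rw [abs_mul]
      gcongr
      exact abs_le.2 ⟨by linarith [hy.1], by linarith [hy.2]⟩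
    linarith
  rw [norm_mul, norm_mul, norm_exp_I_mul_mul_ofReal, norm_exp_I_mul_mul_ofReal]
  calc Real.exp (-(lam.im * x)) * Real.exp (-(lam.im * r)) *
        ‖∫ s in r..x, a s * Complex.exp (-2 * (Complex.I * lam) * s)‖
      ≤ Real.exp (-(lam.im * x)) * Real.exp (-(lam.im * r)) *
          (C * Real.exp (|lam.im| * (x - r) + lam.im * (x + r)) / (2 * ‖lam‖)) := by
        rw [← hκ_norm]
        gcongr
        exact hC r x hr hrx hxT _ hκ _ hexp
    _ = C / 2 / ‖lam‖ * (Real.exp (-(lam.im * x)) * Real.exp (-(lam.im * r)) *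
          Real.exp (|lam.im| * (x - r) + lam.im * (x + r))) := by ring
    _ = C / 2 / ‖lam‖ * Real.exp (|lam.im| * (x - r)) := by
        rw [← Real.exp_add, ← Real.exp_add]
        ring_nf

theorem norm_sub_le_of_eq_add_integral {E : Type*} [NormedAddCommGroup E] [NormedSpace ℝ E]
    {u e : ℝ → E} {F : ℝ → ℝ → E} {ε σ : ℝ} (hT : 0 ≤ T) (hε : 0 ≤ ε) (hεT : ε * T ≤ 1 / 2)
    (hu : ContinuousOn u (Set.Icc 0 T)) (he : ∀ x ∈ Set.Icc 0 T, ‖e x‖ ≤ Real.exp (σ * x))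
    (hF : ∀ x ∈ Set.Icc 0 T, ∀ r ∈ Set.Icc 0 x, ‖F x r‖ ≤ ε * Real.exp (σ * (x - r)) * ‖u r‖)
    (hueq : ∀ x ∈ Set.Icc 0 T, u x - e x = ∫ r in (0 : ℝ)..x, F x r) :
    ∀ x ∈ Set.Icc 0 T, ‖u x - e x‖ ≤ 2 * ε * T * Real.exp (σ * x) := by
  have hweighted : ContinuousOn (fun x ↦ ‖u x‖ * Real.exp (-(σ * x))) (Set.Icc 0 T) := by fun_prop
  obtain ⟨x₀, hx₀, hmax⟩ := isCompact_Icc.exists_isMaxOn ⟨0, Set.left_mem_Icc.2 hT⟩ hweighted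
  set S := ‖u x₀‖ * Real.exp (-(σ * x₀))
  have hS0 : 0 ≤ S := by positivity
  have hu_le : ∀ r ∈ Set.Icc 0 T, ‖u r‖ ≤ S * Real.exp (σ * r) := fun r hr ↦ by
    rw [← mul_inv_le_iff₀ (Real.exp_pos _), ← Real.exp_neg]
    exact hmax hr
  have hdiff : ∀ x ∈ Set.Icc 0 T, ‖u x - e x‖ ≤ ε * T * S * Real.exp (σ * x) := by
    intro x hx
    have hF_le : ∀ r ∈ Set.uIoc 0 x, ‖F x r‖ ≤ ε * S * Real.exp (σ * x) := by
      intro r hr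
      rw [Set.uIoc_of_le hx.1] at hr
      calc ‖F x r‖ ≤ ε * Real.exp (σ * (x - r)) * (S * Real.exp (σ * r)) := by
            refine (hF x hx r ⟨hr.1.le, hr.2⟩).trans ?_
            gcongr
            exact hu_le r ⟨hr.1.le, hr.2.trans hx.2⟩
        _ = ε * S * Real.exp (σ * x) := by
            rw [show σ * x = σ * (x - r) + σ * r by ring, Real.exp_add]
            ring
    calc ‖u x - e x‖ ≤ ε * S * Real.exp (σ * x) * |x - 0| :=
          hueq x hx ▸ intervalIntegral.norm_integral_le_of_norm_le_const hF_le
      _ ≤ ε * S * Real.exp (σ * x) * T := by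
          rw [sub_zero, abs_of_nonneg hx.1]
          gcongr
          exact hx.2
      _ = ε * T * S * Real.exp (σ * x) := by ring
  have hS_le : S ≤ 1 + ε * T * S := by
    have hux₀ : ‖u x₀‖ ≤ (1 + ε * T * S) * Real.exp (σ * x₀) := by
      rw [add_mul, one_mul]
      exact (norm_le_norm_add_norm_sub' _ (e x₀)).trans (add_le_add (he x₀ hx₀) (hdiff x₀ hx₀))
    rwa [← mul_inv_le_iff₀ (Real.exp_pos _), ← Real.exp_neg] at hux₀
  have hS2 : S ≤ 2 := by nlinarith
  intro x hx
  refine (hdiff x hx).trans (mul_le_mul_of_nonneg_right ?_ (Real.exp_pos _).le)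
  nlinarith [mul_nonneg hε hT, hS2]

theorem exists_norm_sub_exp_le_of_canonical_system (hT : 0 ≤ T)
    (ha : BoundedVariationOn a (Set.Icc 0 T)) (hb : BoundedVariationOn b (Set.Icc 0 T)) :
    ∃ C, 0 < C ∧ ∀ (lam : ℂ) (u v : ℝ → ℂ), C ≤ ‖lam‖ →
      IsPrimitiveOn u (fun s ↦ Complex.I * lam * u s + a s * v s) 0 T → u 0 = 1 →
      IsPrimitiveOn v (fun s ↦ -(Complex.I * lam) * v s + b s * u s) 0 T → v 0 = 0 →
      ‖u T - Complex.exp (Complex.I * lam * T)‖ ≤ C / ‖lam‖ * Real.exp (T * |lam.im|) := by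
  obtain ⟨C, hC0, hC⟩ := exists_norm_exp_mul_exp_mul_integral_le ha
  obtain ⟨M, hM0, hM⟩ := exists_norm_le_of_boundedVariationOn hb
  refine ⟨2 * C * M * T + 1, by positivity, fun lam u v hlam hu hu0 hv hv0 ↦ ?_⟩
  have hlam0 : 0 < ‖lam‖ := lt_of_lt_of_le (by positivity) hlam
  have heq := fun x hx ↦ sub_exp_eq_integral_of_canonical_system
    (intervalIntegrable_of_boundedVariationOn hT ha)
    (intervalIntegrable_of_boundedVariationOn hT hb) hu hu0 hv hv0 (x := x) hx
  have hu_cont := hu.continuousOn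
  rw [Set.uIcc_of_le hT] at heq hu_cont
  have hbound := norm_sub_le_of_eq_add_integral hT (ε := C * M / ‖lam‖) (σ := |lam.im|)
    (by positivity) ?_ hu_cont (fun x hx ↦ ?_) (fun x hx r hr ↦ ?_) heq T (Set.right_mem_Icc.2 hT)
  · rw [mul_comm T]
    refine hbound.trans (mul_le_mul_of_nonneg_right ?_ (Real.exp_pos _).le)
    rw [show 2 * (C * M / ‖lam‖) * T = 2 * C * M * T / ‖lam‖ by ring]
    gcongr
    linarith
  · rw [div_mul_eq_mul_div, div_le_iff₀ hlam0]
    linarith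
  · rw [norm_exp_I_mul_mul_ofReal, Real.exp_le_exp, ← neg_mul]
    exact mul_le_mul_of_nonneg_right (neg_le_abs _) hx.1
  · rw [norm_mul, norm_mul (b r)]
    calc _ ≤ C / ‖lam‖ * Real.exp (|lam.im| * (x - r)) * (M * ‖u r‖) := by
          gcongr
          · exact hC lam (norm_pos_iff.1 hlam0) r x hr.1 hr.2 hx.2
          · exact hM r ⟨hr.1, hr.2.trans hx.2⟩
      _ = C * M / ‖lam‖ * Real.exp (|lam.im| * (x - r)) * ‖u r‖ := by ring

end CanonicalSystem

theorem differentiable_inverse_one_sub_add_smul {𝕜 X : Type*} [NontriviallyNormedField 𝕜]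
    [NormedAddCommGroup X] [NormedSpace 𝕜 X] [CompleteSpace X] {A B : X →L[𝕜] X}
    (h : ∀ z : 𝕜, IsUnit (1 - (A + z • B))) :
    Differentiable 𝕜 fun z : 𝕜 ↦ Ring.inverse (1 - (A + z • B)) := by
  have haffine : Differentiable 𝕜 fun z : 𝕜 ↦ 1 - (A + z • B) := by fun_prop
  exact haffine.inverse h

namespace Dirac

/-- Multiplication by a `2 × 2` matrix as a continuous linear map. -/
noncomputable def mulVecCLM (M : Matrix (Fin 2) (Fin 2) ℂ) : (Fin 2 → ℂ) →L[ℂ] (Fin 2 → ℂ) :=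
  LinearMap.toContinuousLinearMap (Matrix.mulVecLin M)

theorem mulVecCLM_apply (M : Matrix (Fin 2) (Fin 2) ℂ) (v : Fin 2 → ℂ) :
    mulVecCLM M v = Matrix.mulVec M v := rfl

/-- The coefficient `-J⁻¹ Q`, where `J = (0, 1; -1, 0)`, extended by zero outside `[0, π]`. -/
noncomputable def potCoeff (p q : ℝ → ℂ) : ℝ → (Fin 2 → ℂ) →L[ℂ] (Fin 2 → ℂ) :=
  (Set.Icc 0 Real.pi).indicator fun s ↦
    p s • mulVecCLM !![0, -1; -1, 0] + q s • mulVecCLM !![1, 0; 0, -1]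

/-- The coefficient `J⁻¹`, where `J = (0, 1; -1, 0)`, extended by zero outside `[0, π]`. -/
noncomputable def rotCoeff : ℝ → (Fin 2 → ℂ) →L[ℂ] (Fin 2 → ℂ) :=
  (Set.Icc 0 Real.pi).indicator fun _ ↦ mulVecCLM !![0, -1; 1, 0]

/-- The coefficient of the first order system `y' = J⁻¹ (λ - Q) y`, which is equivalent to
`l(y, Q) = λ y`. -/
noncomputable def sysCoeff (p q : ℝ → ℂ) (lam : ℂ) (s : ℝ) : (Fin 2 → ℂ) →L[ℂ] (Fin 2 → ℂ) :=
  potCoeff p q s + lam • rotCoeff s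

section Coefficients

variable {p q : ℝ → ℂ} {s : ℝ}

theorem rotCoeff_apply (hs : s ∈ Set.Icc 0 Real.pi) (v : Fin 2 → ℂ) :
    rotCoeff s v = Matrix.mulVec !![0, -1; 1, 0] v := by
  rw [rotCoeff, Set.indicator_of_mem hs, mulVecCLM_apply]

theorem sysCoeff_apply_zero (hs : s ∈ Set.Icc 0 Real.pi) (lam : ℂ) (v : Fin 2 → ℂ) :
    sysCoeff p q lam s v 0 = q s * v 0 - (p s + lam) * v 1 := by
  rw [sysCoeff, potCoeff, rotCoeff, Set.indicator_of_mem hs, Set.indicator_of_mem hs]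
  simp [mulVecCLM_apply, dotProduct]
  ring

theorem sysCoeff_apply_one (hs : s ∈ Set.Icc 0 Real.pi) (lam : ℂ) (v : Fin 2 → ℂ) :
    sysCoeff p q lam s v 1 = (lam - p s) * v 0 - q s * v 1 := by
  rw [sysCoeff, potCoeff, rotCoeff, Set.indicator_of_mem hs, Set.indicator_of_mem hs]
  simp [mulVecCLM_apply, dotProduct]
  ring

end Coefficients

theorem isVolterraCoeff_rotCoeff : IsVolterraCoeff Real.pi rotCoeff where
  aestronglyMeasurable := aestronglyMeasurable_const.indicator measurableSet_Icc
  exists_norm_le := ⟨_, norm_nonneg _, fun _ ↦ norm_indicator_le_norm_self _ _⟩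
  eq_zero _ hs := Set.indicator_of_notMem hs _

/-- The entries of the potential have bounded variation on `[0, π]`. -/
structure IsBVPotential (p q : ℝ → ℂ) : Prop where
  left : BoundedVariationOn p (Set.Icc 0 Real.pi)
  right : BoundedVariationOn q (Set.Icc 0 Real.pi)

variable {p q : ℝ → ℂ}

theorem IsBVPotential.isVolterraCoeff (hQ : IsBVPotential p q) :
    IsVolterraCoeff Real.pi (potCoeff p q) where
  aestronglyMeasurable := (aestronglyMeasurable_indicator_iff measurableSet_Icc).2
    (((aestronglyMeasurable_restrict_of_boundedVariationOn measurableSet_Icc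
        hQ.left).smul_const _).add
      ((aestronglyMeasurable_restrict_of_boundedVariationOn measurableSet_Icc
        hQ.right).smul_const _))
  exists_norm_le := by
    obtain ⟨Mp, hMp, hp⟩ := exists_norm_le_of_boundedVariationOn hQ.left
    obtain ⟨Mq, hMq, hq⟩ := exists_norm_le_of_boundedVariationOn hQ.right
    refine ⟨Mp * ‖mulVecCLM !![0, -1; -1, 0]‖ + Mq * ‖mulVecCLM !![1, 0; 0, -1]‖, by positivity,
      fun s ↦ ?_⟩
    by_cases hs : s ∈ Set.Icc 0 Real.pi
    · rw [potCoeff, Set.indicator_of_mem hs]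
      refine norm_add_le_of_le ?_ ?_ <;> rw [norm_smul]
      · exact mul_le_mul_of_nonneg_right (hp s hs) (norm_nonneg _)
      · exact mul_le_mul_of_nonneg_right (hq s hs) (norm_nonneg _)
    · rw [potCoeff, Set.indicator_of_notMem hs, norm_zero]
      positivity
  eq_zero _ hs := Set.indicator_of_notMem hs _

theorem IsBVPotential.isVolterraCoeff_sysCoeff (hQ : IsBVPotential p q) (lam : ℂ) :
    IsVolterraCoeff Real.pi (sysCoeff p q lam) :=
  hQ.isVolterraCoeff.add (isVolterraCoeff_rotCoeff.const_smul lam)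

/-- The Volterra operator of the system `y' = J⁻¹ (λ - Q) y`. -/
noncomputable def sysOp (hQ : IsBVPotential p q) (lam : ℂ) :
    (ℝ →ᵇ (Fin 2 → ℂ)) →L[ℂ] (ℝ →ᵇ (Fin 2 → ℂ)) :=
  (hQ.isVolterraCoeff_sysCoeff lam).volterra Real.pi_pos.le

/-- The Volterra operator with coefficient `J⁻¹`. -/
noncomputable def rotOp : (ℝ →ᵇ (Fin 2 → ℂ)) →L[ℂ] (ℝ →ᵇ (Fin 2 → ℂ)) :=
  isVolterraCoeff_rotCoeff.volterra Real.pi_pos.le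

theorem sysOp_eq_add_smul_rotOp (hQ : IsBVPotential p q) (lam : ℂ) :
    sysOp hQ lam = hQ.isVolterraCoeff.volterra Real.pi_pos.le + lam • rotOp := by
  rw [rotOp, ← IsVolterraCoeff.volterra_const_smul]
  exact hQ.isVolterraCoeff.volterra_add (isVolterraCoeff_rotCoeff.const_smul lam) _

theorem isUnit_one_sub_sysOp (hQ : IsBVPotential p q) (lam : ℂ) : IsUnit (1 - sysOp hQ lam) :=
  (hQ.isVolterraCoeff_sysCoeff lam).isUnit_one_sub_volterra _

/-- The solution operator of the Volterra equation `y = f + V_λ y` that belongs to the system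
`y' = J⁻¹ (λ - Q) y`. -/
noncomputable def solOp (hQ : IsBVPotential p q) (lam : ℂ) :
    (ℝ →ᵇ (Fin 2 → ℂ)) →L[ℂ] (ℝ →ᵇ (Fin 2 → ℂ)) :=
  Ring.inverse (1 - sysOp hQ lam)

theorem differentiable_solOp (hQ : IsBVPotential p q) : Differentiable ℂ (solOp hQ) := by
  unfold solOp
  simp_rw [sysOp_eq_add_smul_rotOp]
  refine differentiable_inverse_one_sub_add_smul fun lam ↦ ?_
  rw [← sysOp_eq_add_smul_rotOp]
  exact isUnit_one_sub_sysOp hQ lam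

theorem solOp_sub_sysOp_solOp (hQ : IsBVPotential p q) (lam : ℂ) (f : ℝ →ᵇ (Fin 2 → ℂ)) :
    solOp hQ lam f - sysOp hQ lam (solOp hQ lam f) = f :=
  DFunLike.congr_fun (Ring.mul_inverse_cancel _ (isUnit_one_sub_sysOp hQ lam)) f

theorem solOp_sub_sysOp (hQ : IsBVPotential p q) (lam : ℂ) (y : ℝ →ᵇ (Fin 2 → ℂ)) :
    solOp hQ lam (y - sysOp hQ lam y) = y :=
  DFunLike.congr_fun (Ring.inverse_mul_cancel _ (isUnit_one_sub_sysOp hQ lam)) y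

/-- The embedding of `ℂ²` as constant functions, as a continuous linear map. -/
noncomputable def constCLM : (Fin 2 → ℂ) →L[ℂ] (ℝ →ᵇ (Fin 2 → ℂ)) :=
  LinearMap.toContinuousLinearMap
    { toFun := BoundedContinuousFunction.const ℝ
      map_add' := fun _ _ ↦ rfl
      map_smul' := fun _ _ ↦ rfl }

/-- The solution of `y' = J⁻¹ (λ - Q) y` with initial value `c`. -/
noncomputable def sol (hQ : IsBVPotential p q) (lam : ℂ) :
    (Fin 2 → ℂ) →L[ℂ] (ℝ →ᵇ (Fin 2 → ℂ)) :=
  (solOp hQ lam).comp constCLM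

theorem sol_apply (hQ : IsBVPotential p q) (lam : ℂ) (c : Fin 2 → ℂ) (x : ℝ) :
    sol hQ lam c x = c + ∫ s in (0 : ℝ)..x, sysCoeff p q lam s (sol hQ lam c s) :=
  sub_eq_iff_eq_add.1 (DFunLike.congr_fun (solOp_sub_sysOp_solOp hQ lam (constCLM c)) x)

theorem sol_apply_zero (hQ : IsBVPotential p q) (lam : ℂ) (c : Fin 2 → ℂ) :
    sol hQ lam c 0 = c := by
  rw [sol_apply, intervalIntegral.integral_same, add_zero]

theorem isPrimitiveOn_sol (hQ : IsBVPotential p q) (lam : ℂ) (c : Fin 2 → ℂ) :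
    IsPrimitiveOn (sol hQ lam c) (fun s ↦ sysCoeff p q lam s (sol hQ lam c s)) 0 Real.pi := by
  refine ⟨((hQ.isVolterraCoeff_sysCoeff lam).integrable _).intervalIntegrable, fun x _ ↦ ?_⟩
  rw [sol_apply_zero]
  exact sol_apply hQ lam c x

theorem isPrimitiveOn_sol_apply (hQ : IsBVPotential p q) (lam : ℂ) (c : Fin 2 → ℂ) (i : Fin 2) :
    IsPrimitiveOn (fun x ↦ sol hQ lam c x i) (fun s ↦ sysCoeff p q lam s (sol hQ lam c s) i)
      0 Real.pi :=
  (isPrimitiveOn_sol hQ lam c).clm_comp (ContinuousLinearMap.proj (R := ℂ) i)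

theorem differentiable_sol_apply (hQ : IsBVPotential p q) (c : Fin 2 → ℂ) :
    Differentiable ℂ fun lam ↦ sol hQ lam c :=
  (differentiable_solOp hQ).clm_apply (differentiable_const _)

/-- The monodromy matrix, which maps `y(0)` to `y(π)` for the solutions `y` of
`y' = J⁻¹ (λ - Q) y`. -/
noncomputable def monodromy (hQ : IsBVPotential p q) (lam : ℂ) : Matrix (Fin 2) (Fin 2) ℂ :=
  Matrix.of fun i j ↦ sol hQ lam (Pi.single j 1) Real.pi i

theorem sol_apply_pi (hQ : IsBVPotential p q) (lam : ℂ) (c : Fin 2 → ℂ) :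
    sol hQ lam c Real.pi = Matrix.mulVec (monodromy hQ lam) c := by
  have hbasis : c = c 0 • Pi.single 0 1 + c 1 • Pi.single 1 1 := by
    ext i
    fin_cases i <;> simp
  ext i
  conv_lhs => rw [hbasis]
  simp only [map_add, map_smul, BoundedContinuousFunction.coe_add,
    BoundedContinuousFunction.coe_smul, Pi.add_apply, Pi.smul_apply, smul_eq_mul, Matrix.mulVec,
    dotProduct, Fin.sum_univ_two, monodromy, Matrix.of_apply]
  ring

theorem differentiable_monodromy_apply (hQ : IsBVPotential p q) (i j : Fin 2) :
    Differentiable ℂ fun lam ↦ monodromy hQ lam i j :=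
  ((ContinuousLinearMap.proj (R := ℂ) (φ := fun _ : Fin 2 ↦ ℂ) i).comp
    (BoundedContinuousFunction.evalCLM ℂ Real.pi)).differentiable.comp
    (differentiable_sol_apply hQ (Pi.single j 1))

-- The Wronskian `y₀ z₁ - z₀ y₁` is constant since the coefficient of the system is traceless.
theorem det_monodromy (hQ : IsBVPotential p q) (lam : ℂ) : (monodromy hQ lam).det = 1 := by
  set y := sol hQ lam (Pi.single 0 1) with hy
  set z := sol hQ lam (Pi.single 1 1) with hz
  set f : ℝ → ℂ := fun s ↦ (lam - p s) * (y s 0 * z s 0) - (p s + lam) * (y s 1 * z s 1)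
  have hsol := isPrimitiveOn_sol_apply hQ lam
  have hIcc := Set.uIcc_of_le Real.pi_pos.le
  have hyz : IsPrimitiveOn (fun x ↦ y x 0 * z x 1) f 0 Real.pi :=
    ((hsol _ 0).mul (hsol _ 1)).congr fun s hs ↦ by
      rw [hIcc] at hs
      simp only [← hy, ← hz, sysCoeff_apply_zero hs, sysCoeff_apply_one hs, f]
      ring
  have hzy : IsPrimitiveOn (fun x ↦ z x 0 * y x 1) f 0 Real.pi :=
    ((hsol _ 0).mul (hsol _ 1)).congr fun s hs ↦ by
      rw [hIcc] at hs
      simp only [← hy, ← hz, sysCoeff_apply_zero hs, sysCoeff_apply_one hs, f]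
      ring
  have hyz_pi := hyz.eq_add_integral _ Set.right_mem_uIcc
  have hzy_pi := hzy.eq_add_integral _ Set.right_mem_uIcc
  simp only [hy, hz, sol_apply_zero, Pi.single_eq_same, ne_eq, zero_ne_one, one_ne_zero,
    not_false_eq_true, Pi.single_eq_of_ne, mul_zero, mul_one] at hyz_pi hzy_pi
  rw [Matrix.det_fin_two]
  simp only [monodromy, Matrix.of_apply]
  linear_combination hyz_pi - hzy_pi

/-- The discriminant (Lyapunov function) of the system `y' = J⁻¹ (λ - Q) y`. -/
noncomputable def disc (hQ : IsBVPotential p q) (lam : ℂ) : ℂ := (monodromy hQ lam).trace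

theorem differentiable_disc (hQ : IsBVPotential p q) : Differentiable ℂ (disc hQ) := by
  unfold disc
  simp only [Matrix.trace_fin_two]
  exact (differentiable_monodromy_apply hQ 0 0).add (differentiable_monodromy_apply hQ 1 1)

-- For a root `ω` of `ω² = -1` the functions `y₀ + ω y₁` and `y₀ - ω y₁` diagonalise the free
-- system, so that they solve a canonical system.
theorem exists_norm_sol_sub_exp_le (hQ : IsBVPotential p q) {ω : ℂ} (hω : ω * ω = -1) :
    ∃ C, 0 < C ∧ ∀ lam, C ≤ ‖lam‖ →
      ‖sol hQ lam ![1 / 2, -ω / 2] Real.pi 0 + ω * sol hQ lam ![1 / 2, -ω / 2] Real.pi 1 -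
        Complex.exp (ω * lam * Real.pi)‖ ≤ C / ‖lam‖ * Real.exp (Real.pi * |lam.im|) := by
  obtain ⟨C, hC0, hC⟩ := exists_norm_sub_exp_le_of_canonical_system Real.pi_pos.le
    (boundedVariationOn_add hQ.right (boundedVariationOn_const_mul (-ω) hQ.left))
    (boundedVariationOn_add hQ.right (boundedVariationOn_const_mul ω hQ.left))
  refine ⟨C, hC0, fun lam hlam ↦ ?_⟩
  obtain ⟨μ, hμ, hnorm, him⟩ :
      ∃ μ, ω * lam = Complex.I * μ ∧ ‖μ‖ = ‖lam‖ ∧ |μ.im| = |lam.im| := by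
    rcases mul_self_eq_mul_self_iff.1 (hω.trans Complex.I_mul_I.symm) with rfl | rfl
    · exact ⟨lam, rfl, rfl, rfl⟩
    · exact ⟨-lam, by ring, norm_neg lam, by rw [Complex.neg_im, abs_neg]⟩
  set y := sol hQ lam ![1 / 2, -ω / 2] with hy
  have hsol : ∀ κ : ℂ, IsPrimitiveOn (fun x ↦ y x 0 + κ * y x 1)
      (fun s ↦ sysCoeff p q lam s (y s) 0 + κ * sysCoeff p q lam s (y s) 1) 0 Real.pi := fun κ ↦
    (isPrimitiveOn_sol hQ lam _).clm_comp (ContinuousLinearMap.proj (R := ℂ) 0 +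
      κ • ContinuousLinearMap.proj (R := ℂ) 1)
  have hinit : ∀ κ : ℂ, y 0 0 + κ * y 0 1 = 1 / 2 + κ * (-ω / 2) := fun κ ↦ by
    simp only [hy, sol_apply_zero, Matrix.cons_val_zero, Matrix.cons_val_one]
  rw [hμ, ← hnorm, ← him]
  refine hC μ (fun x ↦ y x 0 + ω * y x 1) (fun x ↦ y x 0 + -ω * y x 1) (hlam.trans_eq hnorm.symm)
    ((hsol ω).congr fun s hs ↦ ?_) ?_ ((hsol (-ω)).congr fun s hs ↦ ?_) ?_
  · rw [Set.uIcc_of_le Real.pi_pos.le] at hs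
    simp only [sysCoeff_apply_zero hs, sysCoeff_apply_one hs, ← hμ]
    linear_combination (-(lam + p s) * y s 1) * hω
  · rw [hinit]
    linear_combination (-1 / 2) * hω
  · rw [Set.uIcc_of_le Real.pi_pos.le] at hs
    simp only [sysCoeff_apply_zero hs, sysCoeff_apply_one hs, ← hμ]
    linear_combination (-(lam + p s) * y s 1) * hω
  · rw [hinit]
    linear_combination (1 / 2) * hω

theorem exists_norm_disc_sub_le (hQ : IsBVPotential p q) : ∃ C, 0 < C ∧ ∀ lam : ℂ, C ≤ ‖lam‖ →
    ‖disc hQ lam - 2 * Complex.cos (Real.pi * lam)‖ ≤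
      C / ‖lam‖ * Real.exp (Real.pi * |lam.im|) := by
  obtain ⟨C₁, hC₁, hle₁⟩ := exists_norm_sol_sub_exp_le hQ Complex.I_mul_I
  obtain ⟨C₂, hC₂, hle₂⟩ := exists_norm_sol_sub_exp_le hQ (ω := -Complex.I)
    (by rw [neg_mul_neg, Complex.I_mul_I])
  refine ⟨C₁ + C₂, by positivity, fun lam hlam ↦ ?_⟩
  have hsplit : disc hQ lam - 2 * Complex.cos (Real.pi * lam) =
      (sol hQ lam ![1 / 2, -Complex.I / 2] Real.pi 0 +
        Complex.I * sol hQ lam ![1 / 2, -Complex.I / 2] Real.pi 1 -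
        Complex.exp (Complex.I * lam * Real.pi)) +
      (sol hQ lam ![1 / 2, -(-Complex.I) / 2] Real.pi 0 +
        -Complex.I * sol hQ lam ![1 / 2, -(-Complex.I) / 2] Real.pi 1 -
        Complex.exp (-Complex.I * lam * Real.pi)) := by
    rw [Complex.two_cos, sol_apply_pi, sol_apply_pi, disc, Matrix.trace_fin_two,
      show (Real.pi : ℂ) * lam * Complex.I = Complex.I * lam * Real.pi by ring,
      show -((Real.pi : ℂ) * lam) * Complex.I = -Complex.I * lam * Real.pi by ring]
    simp only [Matrix.mulVec, dotProduct, Fin.sum_univ_two, Matrix.cons_val_zero,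
      Matrix.cons_val_one]
    linear_combination (monodromy hQ lam 1 1) * Complex.I_mul_I
  rw [hsplit, add_div, add_mul]
  exact norm_add_le_of_le (hle₁ lam (by linarith)) (hle₂ lam (by linarith))

section RootSpace

variable {T : L2 →ₗ.[ℂ] L2} {μ : ℂ}

/-- The graph of `T - μ`. -/
noncomputable def shiftedGraph (T : L2 →ₗ.[ℂ] L2) (μ : ℂ) : Submodule ℂ (L2 × L2) :=
  T.graph.comap ((LinearMap.fst ℂ L2 L2).prod (μ • LinearMap.fst ℂ L2 L2 + LinearMap.snd ℂ L2 L2))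

theorem mem_shiftedGraph {f g : L2} : (f, g) ∈ shiftedGraph T μ ↔ (f, μ • f + g) ∈ T.graph :=
  Iff.rfl

theorem eq_zero_of_zero_mem_shiftedGraph {g : L2} (h : (0, g) ∈ shiftedGraph T μ) : g = 0 := by
  rw [mem_shiftedGraph, smul_zero, zero_add] at h
  exact T.graph_fst_eq_zero_snd h rfl

theorem mem_shiftedGraph_iff_exists {f g : L2} :
    (f, g) ∈ shiftedGraph T μ ↔ ∃ x : T.domain, (x : L2) = f ∧ T x - μ • (x : L2) = g := by
  rw [mem_shiftedGraph, LinearPMap.mem_graph_iff]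
  refine exists_congr fun x ↦ and_congr_right fun hx ↦ ?_
  rw [hx, sub_eq_iff_eq_add']

theorem isEigenvalue_iff : IsEigenvalue T μ ↔ ∃ f : L2, f ≠ 0 ∧ (f, 0) ∈ shiftedGraph T μ := by
  simp only [IsEigenvalue, mem_shiftedGraph_iff_exists, sub_eq_zero]
  constructor
  · rintro ⟨x, hx, hTx⟩
    exact ⟨x, fun h ↦ hx (Subtype.ext h), x, rfl, hTx⟩
  · rintro ⟨_, hx, x, rfl, hTx⟩
    exact ⟨x, fun h ↦ hx (congrArg Subtype.val h), hTx⟩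

theorem mem_kerPow_succ {k : ℕ} {f : L2} :
    f ∈ kerPow T μ (k + 1) ↔ ∃ g ∈ kerPow T μ k, (f, g) ∈ shiftedGraph T μ := by
  simp only [mem_shiftedGraph_iff_exists]
  constructor
  · rintro ⟨x, hx, rfl⟩
    exact ⟨_, hx, x, rfl, rfl⟩
  · rintro ⟨_, hg, x, rfl, rfl⟩
    exact ⟨x, hg, rfl⟩

theorem multiplicity_eq_zero (h : ¬ IsEigenvalue T μ) : multiplicity T μ = 0 := by
  have hker : ∀ k, kerPow T μ k = ⊥ := fun k ↦ by
    induction k with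
    | zero => rfl
    | succ k ih =>
      refine (Submodule.eq_bot_iff _).2 fun f hf ↦ ?_
      obtain ⟨g, hg, hfg⟩ := mem_kerPow_succ.1 hf
      rw [ih, Submodule.mem_bot] at hg
      subst hg
      by_contra hf₀
      exact h (isEigenvalue_iff.2 ⟨f, hf₀, hfg⟩)
  simp [multiplicity, hker]

/-- `d 1, …, d n` is a Jordan chain of `T` at the geometrically simple eigenvalue `μ` which cannot
be prolonged. The additional value `d 0 = 0` makes the chain condition uniform. -/
structure IsMaximalJordanChain (T : L2 →ₗ.[ℂ] L2) (μ : ℂ) (n : ℕ) (d : ℕ → L2) : Prop where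
  zero : d 0 = 0
  one_ne_zero : d 1 ≠ 0
  mem_shiftedGraph : ∀ k < n, (d (k + 1), d k) ∈ shiftedGraph T μ
  exists_eq_smul : ∀ f, (f, 0) ∈ shiftedGraph T μ → ∃ c : ℂ, f = c • d 1
  notMem_shiftedGraph : ∀ f, (f, d n) ∉ shiftedGraph T μ

namespace IsMaximalJordanChain

variable {n : ℕ} {d : ℕ → L2}

theorem pos (h : IsMaximalJordanChain T μ n d) : 0 < n := by
  refine Nat.pos_of_ne_zero fun hn ↦ h.notMem_shiftedGraph 0 ?_
  rw [hn, h.zero]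
  exact Submodule.zero_mem _

theorem sum_mem_shiftedGraph (h : IsMaximalJordanChain T μ n d) {ι : Type*} {s : Finset ι}
    (c : ι → ℂ) {i : ι → ℕ} (hi : ∀ k ∈ s, i k < n) :
    (∑ k ∈ s, c k • d (i k + 1), ∑ k ∈ s, c k • d (i k)) ∈ shiftedGraph T μ := by
  have hsum := Submodule.sum_mem _ fun k hk ↦
    Submodule.smul_mem _ (c k) (h.mem_shiftedGraph (i k) (hi k hk))
  rwa [← Prod.mk.eta (p := Finset.sum _ _), Prod.fst_sum, Prod.snd_sum] at hsum

theorem eq_zero_of_sum_eq_zero (h : IsMaximalJordanChain T μ n d) {j : ℕ} (hj : j ≤ n)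
    {c : ℕ → ℂ} (hc : ∑ k ∈ Finset.range j, c k • d (k + 1) = 0) : ∀ k < j, c k = 0 := by
  induction j generalizing c with
  | zero => simp
  | succ j ih =>
    have hshift := h.sum_mem_shiftedGraph c (s := Finset.range (j + 1)) (i := id)
      fun k hk ↦ (Finset.mem_range.1 hk).trans_le hj
    simp only [id_eq] at hshift
    rw [hc, Finset.sum_range_succ', h.zero, smul_zero, add_zero] at hshift
    have hsucc := ih (Nat.le_of_succ_le hj) (eq_zero_of_zero_mem_shiftedGraph hshift)
    rw [Finset.sum_range_succ', Finset.sum_eq_zero fun k hk ↦ by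
      rw [hsucc k (Finset.mem_range.1 hk), zero_smul], zero_add] at hc
    rintro (_ | k) hk
    · exact (smul_eq_zero.1 hc).resolve_right h.one_ne_zero
    · exact hsucc k (Nat.succ_lt_succ_iff.1 hk)

theorem linearIndependent (h : IsMaximalJordanChain T μ n d) :
    LinearIndependent ℂ fun k : Fin n ↦ d (k + 1) := by
  refine Fintype.linearIndependent_iff.2 fun b hb i ↦ ?_
  have hc := h.eq_zero_of_sum_eq_zero le_rfl
    (c := fun k ↦ if hk : k < n then b ⟨k, hk⟩ else 0) (by
      rw [← hb, Finset.sum_range]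
      simp only [Fin.is_lt, dite_true]) i i.2
  simpa only [Fin.is_lt, dite_true] using hc

theorem mem_span_of_mem_shiftedGraph (h : IsMaximalJordanChain T μ n d) {f g : L2}
    (hfg : (f, g) ∈ shiftedGraph T μ)
    (hg : g ∈ Submodule.span ℂ (Set.range fun k : Fin n ↦ d (k + 1))) :
    f ∈ Submodule.span ℂ (Set.range fun k : Fin n ↦ d (k + 1)) := by
  obtain ⟨m, rfl⟩ := Nat.exists_eq_succ_of_ne_zero h.pos.ne'
  obtain ⟨b, rfl⟩ := (Submodule.mem_span_range_iff_exists_fun ℂ).1 hg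
  set s := ∑ k : Fin m, b k.castSucc • d (k + 1 + 1) with hs
  have hdiff : (f - s, b (Fin.last m) • d (m + 1)) ∈ shiftedGraph T μ := by
    have hshift := h.sum_mem_shiftedGraph (s := Finset.univ) (fun k : Fin m ↦ b k.castSucc)
      (i := fun k ↦ k + 1) fun k _ ↦ Nat.succ_lt_succ k.2
    rw [Fin.sum_univ_castSucc] at hfg
    simpa [← hs] using Submodule.sub_mem _ hfg hshift
  have hlast : b (Fin.last m) = 0 := by
    by_contra hb
    have hmem := Submodule.smul_mem _ (b (Fin.last m))⁻¹ hdiff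
    rw [Prod.smul_mk, inv_smul_smul₀ hb] at hmem
    exact h.notMem_shiftedGraph _ hmem
  rw [hlast, zero_smul] at hdiff
  obtain ⟨a, ha⟩ := h.exists_eq_smul _ hdiff
  have hmem : ∀ k : Fin (m + 1),
      d (k + 1) ∈ Submodule.span ℂ (Set.range fun k : Fin (m + 1) ↦ d (k + 1)) := fun k ↦
    Submodule.subset_span ⟨k, rfl⟩
  rw [sub_eq_iff_eq_add.1 ha]
  exact Submodule.add_mem _ (Submodule.smul_mem _ _ (hmem 0))
    (Submodule.sum_mem _ fun k _ ↦ Submodule.smul_mem _ _ (hmem k.succ))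

theorem mem_kerPow (h : IsMaximalJordanChain T μ n d) {k : ℕ} (hk : k ≤ n) :
    d k ∈ kerPow T μ k := by
  induction k with
  | zero => exact h.zero ▸ Submodule.zero_mem _
  | succ k ih => exact mem_kerPow_succ.2 ⟨_, ih (Nat.le_of_succ_le hk), h.mem_shiftedGraph k hk⟩

theorem iSup_kerPow_eq_span (h : IsMaximalJordanChain T μ n d) :
    (⨆ k, kerPow T μ k) = Submodule.span ℂ (Set.range fun k : Fin n ↦ d (k + 1)) := by
  refine le_antisymm (iSup_le fun k ↦ ?_) (Submodule.span_le.2 ?_)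
  · induction k with
    | zero => exact bot_le
    | succ k ih =>
      intro f hf
      obtain ⟨g, hg, hfg⟩ := mem_kerPow_succ.1 hf
      exact h.mem_span_of_mem_shiftedGraph hfg (ih hg)
  · rintro _ ⟨k, rfl⟩
    exact Submodule.mem_iSup_of_mem _ (h.mem_kerPow k.2)

theorem multiplicity_eq (h : IsMaximalJordanChain T μ n d) : multiplicity T μ = n := by
  rw [multiplicity, h.iSup_kerPow_eq_span, rank_span h.linearIndependent,
    Cardinal.mk_range_eq _ h.linearIndependent.injective]
  simp

theorem isEigenvalue (h : IsMaximalJordanChain T μ n d) : IsEigenvalue T μ :=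
  isEigenvalue_iff.2 ⟨d 1, h.one_ne_zero, h.zero ▸ h.mem_shiftedGraph 0 h.pos⟩

end IsMaximalJordanChain

end RootSpace

section Embedding

theorem memLp_toLp (y : ℝ →ᵇ (Fin 2 → ℂ)) : MemLp (fun x ↦ WithLp.toLp 2 (y x)) 2 mu := by
  set e := (PiLp.continuousLinearEquiv 2 ℂ (fun _ : Fin 2 ↦ ℂ)).symm.toContinuousLinearMap
  exact MemLp.of_bound (e.compLeftContinuousBounded ℝ y).continuous.aestronglyMeasurable _
    (.of_forall (e.compLeftContinuousBounded ℝ y).norm_coe_le_norm)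

/-- The class of a bounded continuous function in `L₂²[0, π]`. -/
noncomputable def toL2 : (ℝ →ᵇ (Fin 2 → ℂ)) →ₗ[ℂ] L2 where
  toFun y := (memLp_toLp y).toLp
  map_add' _ _ := rfl
  map_smul' _ _ := rfl

theorem toL2_apply_ae (y : ℝ →ᵇ (Fin 2 → ℂ)) : ∀ᵐ x ∂mu, (toL2 y x).ofLp = y x := by
  filter_upwards [(memLp_toLp y).coeFn_toLp] with x hx
  exact congrArg WithLp.ofLp hx

theorem toL2_ne_zero {y : ℝ →ᵇ (Fin 2 → ℂ)} (hy : y 0 ≠ 0) : toL2 y ≠ 0 := by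
  intro h
  have hae : ∀ᵐ x ∂mu, y x = 0 := by
    filter_upwards [toL2_apply_ae y, Lp.coeFn_zero (EuclideanSpace ℂ (Fin 2)) 2 mu] with x hx hx'
    rw [← hx, h]
    exact congrArg WithLp.ofLp hx'
  rw [mu, ← Measure.restrict_congr_set Ioo_ae_eq_Icc] at hae
  have heqOn := (Measure.eqOn_open_of_ae_eq hae isOpen_Ioo y.continuous.continuousOn
    continuousOn_const).closure y.continuous continuous_const
  rw [closure_Ioo Real.pi_pos.ne] at heqOn
  exact hy (heqOn (Set.left_mem_Icc.2 Real.pi_pos.le))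

variable {p q : ℝ → ℂ}

theorem eq_sysCoeff_apply_add_iff {s : ℝ} (hs : s ∈ Set.Icc 0 Real.pi) (lam : ℂ)
    (v w d : Fin 2 → ℂ) :
    d = sysCoeff p q lam s v + rotCoeff s w ↔
      lam • v + w = Matrix.mulVec !![0, 1; -1, 0] d + Matrix.mulVec (potential p q s) v := by
  rw [funext_iff, funext_iff, Fin.forall_fin_two, Fin.forall_fin_two, rotCoeff_apply hs w,
    Pi.add_apply, Pi.add_apply, sysCoeff_apply_zero hs, sysCoeff_apply_one hs]
  simp only [Matrix.mulVec, dotProduct, Fin.sum_univ_two, potential, Pi.add_apply, Pi.smul_apply,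
    smul_eq_mul, Matrix.of_apply, Matrix.cons_val_zero, Matrix.cons_val_one]
  constructor
  · rintro ⟨h₀, h₁⟩
    rw [h₀, h₁]
    constructor <;> ring
  · rintro ⟨h₀, h₁⟩
    constructor
    · linear_combination h₁
    · linear_combination -h₀

theorem ae_ofLp_smul_add_toL2 {y : ℝ → Fin 2 → ℂ} {f : L2} (hf : ∀ᵐ x ∂mu, (f x).ofLp = y x)
    (μ : ℂ) (g : ℝ →ᵇ (Fin 2 → ℂ)) :
    ∀ᵐ x ∂mu, ((μ • f + toL2 g) x).ofLp = μ • y x + g x := by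
  filter_upwards [hf, toL2_apply_ae g, Lp.coeFn_add (μ • f) (toL2 g), Lp.coeFn_smul μ f] with
    x hfx hgx hadd hsmul
  rw [hadd, Pi.add_apply, hsmul, Pi.smul_apply, WithLp.ofLp_add, WithLp.ofLp_smul, hfx, hgx]

theorem ae_smul_add_eq_diffExpr_iff {y : ℝ → Fin 2 → ℂ}
    (hy : AbsolutelyContinuousOnInterval y 0 Real.pi) (μ : ℂ) (g : ℝ → Fin 2 → ℂ) :
    (∀ᵐ x ∂mu, μ • y x + g x = diffExpr p q y x) ↔
      ∀ᵐ x, x ∈ Set.uIcc 0 Real.pi →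
        HasDerivAt y (sysCoeff p q μ x (y x) + rotCoeff x (g x)) x := by
  rw [Set.uIcc_of_le Real.pi_pos.le, ← ae_restrict_iff' measurableSet_Icc]
  refine Filter.eventually_congr ?_
  filter_upwards [ae_differentiableAt hy, ae_restrict_mem measurableSet_Icc] with x hdiff hx
  rw [diffExpr, ← eq_sysCoeff_apply_add_iff hx]
  exact ⟨fun h ↦ h ▸ hdiff.hasDerivAt, HasDerivAt.deriv⟩

theorem isPrimitiveOn_of_sub_sysOp_eq (hQ : IsBVPotential p q) {μ : ℂ}
    {y g : ℝ →ᵇ (Fin 2 → ℂ)} (hy : y - sysOp hQ μ y = constCLM (y 0) + rotOp g) :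
    IsPrimitiveOn y (fun s ↦ sysCoeff p q μ s (y s) + rotCoeff s (g s)) 0 Real.pi := by
  have hsys := (hQ.isVolterraCoeff_sysCoeff μ).integrable y
  have hrot := isVolterraCoeff_rotCoeff.integrable g
  refine ⟨(hsys.add hrot).intervalIntegrable, fun x _ ↦ ?_⟩
  rw [intervalIntegral.integral_add hsys.intervalIntegrable hrot.intervalIntegrable,
    add_comm (intervalIntegral _ _ _ _), ← add_assoc]
  exact sub_eq_iff_eq_add.1 (DFunLike.congr_fun hy x)

theorem sub_sysOp_eq_of_isPrimitiveOn (hQ : IsBVPotential p q) {μ : ℂ}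
    {y g : ℝ →ᵇ (Fin 2 → ℂ)}
    (hy : IsPrimitiveOn y (fun s ↦ sysCoeff p q μ s (y s) + rotCoeff s (g s)) 0 Real.pi)
    (hleft : ∀ x ≤ 0, y x = y 0) (hright : ∀ x, Real.pi ≤ x → y x = y Real.pi) :
    y - sysOp hQ μ y = constCLM (y 0) + rotOp g := by
  have hsys := (hQ.isVolterraCoeff_sysCoeff μ).integrable y
  have hrot := isVolterraCoeff_rotCoeff.integrable g
  have hmem : ∀ x ∈ Set.Icc 0 Real.pi, y x = y 0 + rotOp g x + sysOp hQ μ y x := fun x hx ↦ by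
    rw [hy.eq_add_integral x (Set.Icc_subset_uIcc hx), intervalIntegral.integral_add
      hsys.intervalIntegrable hrot.intervalIntegrable, add_comm (intervalIntegral _ _ _ _),
      ← add_assoc]
    rfl
  ext1 x
  refine sub_eq_iff_eq_add.2 (?_ : y x = y 0 + rotOp g x + sysOp hQ μ y x)
  rcases le_total x 0 with hx | hx
  · rw [hleft x hx, rotOp, sysOp, IsVolterraCoeff.volterra_apply_of_nonpos _ _ _ hx,
      IsVolterraCoeff.volterra_apply_of_nonpos _ _ _ hx, add_zero, add_zero]
  rcases le_total x Real.pi with hxpi | hxpi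
  · exact hmem x ⟨hx, hxpi⟩
  · rw [hright x hxpi, rotOp, sysOp, IsVolterraCoeff.volterra_apply_of_le _ _ _ hxpi,
      IsVolterraCoeff.volterra_apply_of_le _ _ _ hxpi]
    exact hmem Real.pi (Set.right_mem_Icc.2 Real.pi_pos.le)

/-- The boundary form `y(π) - e^{iπt} y(0)`. -/
noncomputable def boundaryCLM (t : ℂ) : (ℝ →ᵇ (Fin 2 → ℂ)) →L[ℂ] (Fin 2 → ℂ) :=
  BoundedContinuousFunction.evalCLM ℂ Real.pi -
    Complex.exp (Complex.I * Real.pi * t) • BoundedContinuousFunction.evalCLM ℂ 0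

theorem boundaryCLM_apply (t : ℂ) (y : ℝ →ᵇ (Fin 2 → ℂ)) :
    boundaryCLM t y = y Real.pi - Complex.exp (Complex.I * Real.pi * t) • y 0 := rfl

theorem toL2_mem_shiftedGraph (hQ : IsBVPotential p q) {t μ : ℂ} {y g : ℝ →ᵇ (Fin 2 → ℂ)}
    (hy : y - sysOp hQ μ y = constCLM (y 0) + rotOp g) (hb : boundaryCLM t y = 0) :
    (toL2 y, toL2 g) ∈ shiftedGraph (operator p q t) μ := by
  have hprim := isPrimitiveOn_of_sub_sysOp_eq hQ hy
  have hac := hprim.absolutelyContinuousOnInterval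
  rw [mem_shiftedGraph, graph_operator]
  refine ⟨y, ⟨hac, sub_eq_zero.1 hb⟩, toL2_apply_ae y, ?_⟩
  filter_upwards [ae_ofLp_smul_add_toL2 (toL2_apply_ae y) μ g,
    (ae_smul_add_eq_diffExpr_iff hac μ g).2 hprim.ae_hasDerivAt] with x hx hdiff
  exact hx.trans hdiff

theorem exists_boundedContinuousFunction_eqOn_Icc {E : Type*} [NormedAddCommGroup E] {a b : ℝ}
    (hab : a ≤ b) {y : ℝ → E} (hy : ContinuousOn y (Set.Icc a b)) :
    ∃ z : ℝ →ᵇ E, Set.EqOn z y (Set.Icc a b) ∧ (∀ x ≤ a, z x = z a) ∧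
      ∀ x, b ≤ x → z x = z b := by
  set w := (Set.Icc a b).domRestrict y
  obtain ⟨C, hC⟩ := isCompact_Icc.exists_bound_of_continuousOn hy
  refine ⟨BoundedContinuousFunction.ofNormedAddCommGroup (Set.IccExtend hab w)
    hy.domRestrict.Icc_extend' C fun x ↦ hC _ (Set.projIcc a b hab x).2,
    fun x hx ↦ Set.IccExtend_of_mem hab w hx, fun x hx ↦ ?_, fun x hx ↦ ?_⟩
  · exact (Set.IccExtend_of_le_left hab w hx).trans (Set.IccExtend_left hab w).symm
  · exact (Set.IccExtend_of_right_le hab w hx).trans (Set.IccExtend_right hab w).symm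

theorem exists_of_mem_shiftedGraph (hQ : IsBVPotential p q) {t μ : ℂ} {f : L2}
    {g : ℝ →ᵇ (Fin 2 → ℂ)} (hf : (f, toL2 g) ∈ shiftedGraph (operator p q t) μ) :
    ∃ y : ℝ →ᵇ (Fin 2 → ℂ), f = toL2 y ∧
      y - sysOp hQ μ y = constCLM (y 0) + rotOp g ∧ boundaryCLM t y = 0 := by
  rw [mem_shiftedGraph, graph_operator] at hf
  obtain ⟨y, ⟨hac, hb⟩, hfy, hdiff⟩ := hf
  have hIcc := Set.uIcc_of_le Real.pi_pos.le
  obtain ⟨z, hz, hleft, hright⟩ := exists_boundedContinuousFunction_eqOn_Icc Real.pi_pos.le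
    (hIcc ▸ hac.continuousOn)
  have hderiv : ∀ᵐ x, x ∈ Set.uIcc 0 Real.pi →
      HasDerivAt y (sysCoeff p q μ x (z x) + rotCoeff x (g x)) x := by
    have hode : ∀ᵐ x ∂mu, μ • y x + g x = diffExpr p q y x := by
      filter_upwards [ae_ofLp_smul_add_toL2 hfy μ g, hdiff] with x hx hx'
      exact hx.symm.trans hx'
    filter_upwards [(ae_smul_add_eq_diffExpr_iff hac μ g).1 hode] with x hx hxmem
    rw [hz (hIcc ▸ hxmem)]
    exact hx hxmem
  have hprim : IsPrimitiveOn y (fun s ↦ sysCoeff p q μ s (z s) + rotCoeff s (g s)) 0 Real.pi :=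
    .of_ae_hasDerivAt hac (((hQ.isVolterraCoeff_sysCoeff μ).integrable z).add
      (isVolterraCoeff_rotCoeff.integrable g)).intervalIntegrable hderiv
  have hprimz : IsPrimitiveOn z (fun s ↦ sysCoeff p q μ s (z s) + rotCoeff s (g s)) 0 Real.pi :=
    ⟨hprim.intervalIntegrable, fun x hx ↦ by
      rw [hz (hIcc ▸ hx), hz (Set.left_mem_Icc.2 Real.pi_pos.le), hprim.eq_add_integral x hx]⟩
  refine ⟨z, Lp.ext ?_, sub_sysOp_eq_of_isPrimitiveOn hQ hprimz hleft hright, ?_⟩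
  · filter_upwards [hfy, toL2_apply_ae z, ae_restrict_mem measurableSet_Icc] with x hfx hzx hx
    rw [hz hx] at hzx
    exact WithLp.ofLp_injective 2 (hfx.trans hzx.symm)
  · rw [boundaryCLM_apply, hz (Set.left_mem_Icc.2 Real.pi_pos.le),
      hz (Set.right_mem_Icc.2 Real.pi_pos.le), hb, sub_self]

end Embedding

end Dirac

section TaylorChain

variable {𝕜 X V : Type*} [NontriviallyNormedField 𝕜] [NormedAddCommGroup X] [NormedSpace 𝕜 X]
  [NormedAddCommGroup V] [NormedSpace 𝕜 V] {Y : 𝕜 → X}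

theorem iteratedDeriv_clm_apply (B : X →L[𝕜] V) {k : ℕ} {z : 𝕜} (hY : ContDiffAt 𝕜 k Y z) :
    iteratedDeriv k (fun z ↦ B (Y z)) z = B (iteratedDeriv k Y z) := by
  rw [iteratedDeriv, iteratedDeriv]
  exact congrArg (· fun _ ↦ 1) (B.iteratedFDeriv_comp_left hY le_rfl)

theorem iteratedDeriv_succ_eq_of_forall_eq (S R : X →L[𝕜] X) (hY : ∀ n : ℕ, ContDiff 𝕜 n Y)
    (h : ∀ z, Y z = S (Y z) + z • R (Y z)) (k : ℕ) (z : 𝕜) :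
    iteratedDeriv (k + 1) Y z = S (iteratedDeriv (k + 1) Y z) +
      z • R (iteratedDeriv (k + 1) Y z) + (k + 1 : 𝕜) • R (iteratedDeriv k Y z) := by
  have hderiv : ∀ k z, HasDerivAt (iteratedDeriv k Y) (iteratedDeriv (k + 1) Y z) z := fun k z ↦ by
    rw [iteratedDeriv_succ]
    exact ((hY (k + 1)).differentiable_iteratedDeriv k (by exact_mod_cast k.lt_succ_self)
      z).hasDerivAt
  have hSR : ∀ k z, HasDerivAt (fun z ↦ S (iteratedDeriv k Y z) + z • R (iteratedDeriv k Y z))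
      (S (iteratedDeriv (k + 1) Y z) +
        (z • R (iteratedDeriv (k + 1) Y z) + (1 : 𝕜) • R (iteratedDeriv k Y z))) z := fun k z ↦
    (S.hasFDerivAt.comp_hasDerivAt z (hderiv k z)).add
      ((hasDerivAt_id z).smul (R.hasFDerivAt.comp_hasDerivAt z (hderiv k z)))
  induction k generalizing z with
  | zero =>
    have hzero := (hderiv 0 z).unique
      ((hSR 0 z).congr_of_eventuallyEq (.of_forall fun z ↦ by simpa using h z))
    simpa [add_assoc] using hzero
  | succ k ih =>
    have hR := (R.hasFDerivAt.comp_hasDerivAt z (hderiv k z)).const_smul (k + 1 : 𝕜)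
    have hsucc := (hderiv (k + 1) z).unique
      (((hSR (k + 1) z).add hR).congr_of_eventuallyEq (.of_forall ih))
    rw [Nat.cast_succ, add_smul (k + 1 : 𝕜) 1, add_comm (_ • _) ((1 : 𝕜) • _)]
    simpa only [add_assoc] using hsucc

/-- The Taylor coefficients of `Y` at `a`, with indices shifted by one and preceded by `0`: the
coefficient of `(z - a) ^ k` is `taylorChain Y a (k + 1)`. If every `Y z` is an eigenvector at `z`
of an operator pencil, this is a Jordan chain of the pencil at `a`. -/
noncomputable def taylorChain (Y : 𝕜 → X) (a : 𝕜) : ℕ → X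
  | 0 => 0
  | k + 1 => (k.factorial : 𝕜)⁻¹ • iteratedDeriv k Y a

theorem taylorChain_one (Y : 𝕜 → X) (a : 𝕜) : taylorChain Y a 1 = Y a := by
  simp [taylorChain]

theorem clm_taylorChain_succ (B : X →L[𝕜] V) (k : ℕ) {a : 𝕜} (hY : ContDiffAt 𝕜 k Y a) :
    B (taylorChain Y a (k + 1)) =
      (k.factorial : 𝕜)⁻¹ • iteratedDeriv k (fun z ↦ B (Y z)) a := by
  rw [taylorChain, map_smul, iteratedDeriv_clm_apply B hY]

theorem taylorChain_succ_eq [CharZero 𝕜] (S R : X →L[𝕜] X) (hY : ∀ n : ℕ, ContDiff 𝕜 n Y)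
    (h : ∀ z, Y z = S (Y z) + z • R (Y z)) (a : 𝕜) (k : ℕ) :
    taylorChain Y a (k + 1) = S (taylorChain Y a (k + 1)) + a • R (taylorChain Y a (k + 1)) +
      R (taylorChain Y a k) := by
  cases k with
  | zero => simpa [taylorChain] using h a
  | succ k =>
    have hk : (k + 1 : 𝕜) ≠ 0 := k.cast_add_one_ne_zero
    have hfact : (((k + 1).factorial : ℕ) : 𝕜)⁻¹ * (k + 1) = (k.factorial : 𝕜)⁻¹ := by
      rw [Nat.factorial_succ, Nat.cast_mul, Nat.cast_succ, mul_inv_rev, mul_assoc,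
        inv_mul_cancel₀ hk, mul_one]
    simp only [taylorChain]
    conv_lhs => rw [iteratedDeriv_succ_eq_of_forall_eq S R hY h k a]
    rw [smul_add, smul_add, map_smul, map_smul, map_smul, smul_comm a,
      smul_smul _ (k + 1 : 𝕜), hfact]

end TaylorChain

theorem exists_eq_smul_of_mulVec_eq_zero {K : Type*} [Field K] {A : Matrix (Fin 2) (Fin 2) K}
    (hA : A ≠ 0) {w x : Fin 2 → K} (hw : w ≠ 0) (hAw : A.mulVec w = 0) (hAx : A.mulVec x = 0) :
    ∃ c : K, x = c • w := by
  by_contra! hne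
  have hunit : IsUnit (Matrix.of ![w, x]) := Matrix.linearIndependent_rows_iff_isUnit.1
    ((LinearIndependent.pair_iff' hw).2 fun c ↦ (hne c).symm)
  have hmul : A * (Matrix.of ![w, x]).transpose = 0 := by
    ext i j
    fin_cases j
    · exact congrFun hAw i
    · exact congrFun hAx i
  rw [← Matrix.isUnit_transpose] at hunit
  exact hA (hunit.mul_left_eq_zero.1 hmul)

theorem adjugate_fin_two_ne_zero {K : Type*} [CommRing K] {A : Matrix (Fin 2) (Fin 2) K}
    (hA : A ≠ 0) : A.adjugate ≠ 0 := fun h ↦ hA <| by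
  simpa [h] using (A.adjugate_adjugate (by simp)).symm

namespace Dirac

section Characteristic

variable {p q : ℝ → ℂ}

/-- The characteristic function of `L_t(Q)`. -/
noncomputable def charFun (hQ : IsBVPotential p q) (t lam : ℂ) : ℂ :=
  2 * Complex.cos (Real.pi * t) - disc hQ lam

theorem differentiable_charFun (hQ : IsBVPotential p q) (t : ℂ) :
    Differentiable ℂ (charFun hQ t) :=
  (differentiable_const _).sub (differentiable_disc hQ)

/-- The matrix of the boundary form on the solutions of the system, parametrized by their initial
values. -/
noncomputable def charMatrix (hQ : IsBVPotential p q) (t lam : ℂ) : Matrix (Fin 2) (Fin 2) ℂ :=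
  monodromy hQ lam - Complex.exp (Complex.I * Real.pi * t) • 1

theorem boundaryCLM_sol (hQ : IsBVPotential p q) (t lam : ℂ) (c : Fin 2 → ℂ) :
    boundaryCLM t (sol hQ lam c) = (charMatrix hQ t lam).mulVec c := by
  rw [charMatrix, Matrix.sub_mulVec, Matrix.smul_mulVec, Matrix.one_mulVec, boundaryCLM_apply,
    sol_apply_pi, sol_apply_zero]

theorem differentiable_charMatrix_apply (hQ : IsBVPotential p q) (t : ℂ) (i j : Fin 2) :
    Differentiable ℂ fun lam ↦ charMatrix hQ t lam i j :=
  (differentiable_monodromy_apply hQ i j).sub (differentiable_const _)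

theorem det_charMatrix (hQ : IsBVPotential p q) (t lam : ℂ) :
    (charMatrix hQ t lam).det = Complex.exp (Complex.I * Real.pi * t) * charFun hQ t lam := by
  have hdet := det_monodromy hQ lam
  have hexp : Complex.exp (Real.pi * t * Complex.I) *
      Complex.exp (-(Real.pi * t) * Complex.I) = 1 := by
    rw [← Complex.exp_add, ← add_mul, add_neg_cancel, zero_mul, Complex.exp_zero]
  rw [charFun, Complex.two_cos, charMatrix, disc, Matrix.trace_fin_two, Matrix.det_fin_two,
    show Complex.I * Real.pi * t = Real.pi * t * Complex.I by ring]
  rw [Matrix.det_fin_two] at hdet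
  simp only [Matrix.sub_apply, Matrix.smul_apply, Matrix.one_apply_eq, ne_eq, zero_ne_one,
    not_false_eq_true, Matrix.one_apply_ne, one_ne_zero, smul_eq_mul, mul_one, mul_zero, sub_zero]
  linear_combination hdet - hexp

theorem charMatrix_ne_zero (hQ : IsBVPotential p q) {t : ℂ} (ht : ∀ m : ℤ, t ≠ m) (lam : ℂ) :
    charMatrix hQ t lam ≠ 0 := by
  intro h
  have hdet := det_monodromy hQ lam
  rw [sub_eq_zero.1 h, Matrix.det_smul, Matrix.det_one, mul_one, Fintype.card_fin,
    ← Complex.exp_nat_mul, Complex.exp_eq_one_iff] at hdet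
  obtain ⟨m, hm⟩ := hdet
  refine ht m (mul_left_cancel₀ Complex.two_pi_I_ne_zero ?_)
  push_cast at hm
  linear_combination hm

theorem eq_sol_of_sub_sysOp_eq (hQ : IsBVPotential p q) {lam : ℂ} {y : ℝ →ᵇ (Fin 2 → ℂ)}
    (h : y - sysOp hQ lam y = constCLM (y 0)) : y = sol hQ lam (y 0) := by
  rw [sol, ContinuousLinearMap.comp_apply, ← h, solOp_sub_sysOp]

theorem exists_eq_toL2_sol (hQ : IsBVPotential p q) {t lam : ℂ} {f : L2}
    (hf : (f, 0) ∈ shiftedGraph (operator p q t) lam) :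
    ∃ c, f = toL2 (sol hQ lam c) ∧ (charMatrix hQ t lam).mulVec c = 0 := by
  obtain ⟨y, rfl, hy, hb⟩ := exists_of_mem_shiftedGraph hQ (g := 0) (by rwa [map_zero])
  rw [map_zero rotOp, add_zero] at hy
  have hsol := eq_sol_of_sub_sysOp_eq hQ hy
  exact ⟨y 0, congrArg toL2 hsol, by rw [← boundaryCLM_sol, ← hsol, hb]⟩

theorem charFun_eq_zero_of_isEigenvalue (hQ : IsBVPotential p q) {t lam : ℂ}
    (h : IsEigenvalue (operator p q t) lam) : charFun hQ t lam = 0 := by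
  obtain ⟨f, hf₀, hf⟩ := isEigenvalue_iff.1 h
  obtain ⟨c, rfl, hc⟩ := exists_eq_toL2_sol hQ hf
  have hc₀ : c ≠ 0 := fun hc₀ ↦ hf₀ (by rw [hc₀, map_zero, map_zero])
  have hdet := Matrix.exists_mulVec_eq_zero_iff.1 ⟨c, hc₀, hc⟩
  rw [det_charMatrix] at hdet
  exact (mul_eq_zero.1 hdet).resolve_left (Complex.exp_ne_zero _)

/-- The solutions of the system for which the boundary form is `e^{iπt} charFun t λ • v`: at a zero
of the characteristic function, they are eigenfunctions. -/
noncomputable def rootFamily (hQ : IsBVPotential p q) (t : ℂ) (v : Fin 2 → ℂ) (lam : ℂ) :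
    ℝ →ᵇ (Fin 2 → ℂ) :=
  sol hQ lam ((charMatrix hQ t lam).adjugate.mulVec v)

theorem boundaryCLM_rootFamily (hQ : IsBVPotential p q) (t : ℂ) (v : Fin 2 → ℂ) (lam : ℂ) :
    boundaryCLM t (rootFamily hQ t v lam) =
      charFun hQ t lam • Complex.exp (Complex.I * Real.pi * t) • v := by
  rw [rootFamily, boundaryCLM_sol, Matrix.mulVec_mulVec, Matrix.mul_adjugate, Matrix.smul_mulVec,
    Matrix.one_mulVec, det_charMatrix, smul_smul, mul_comm]

theorem differentiable_rootFamily (hQ : IsBVPotential p q) (t : ℂ) (v : Fin 2 → ℂ) :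
    Differentiable ℂ (rootFamily hQ t v) := by
  have hentry := differentiable_charMatrix_apply hQ t
  have hinit : Differentiable ℂ fun lam ↦ (charMatrix hQ t lam).adjugate.mulVec v := by
    refine differentiable_pi.2 fun i ↦ ?_
    fin_cases i <;>
      simp only [Fin.zero_eta, Fin.mk_one, Matrix.adjugate_fin_two, Matrix.mulVec, dotProduct,
        Fin.sum_univ_two, Matrix.of_apply, Matrix.cons_val_zero, Matrix.cons_val_one] <;>
      fun_prop
  exact (differentiable_solOp hQ).clm_apply (constCLM.differentiable.comp hinit)

theorem contDiff_rootFamily (hQ : IsBVPotential p q) (t : ℂ) (v : Fin 2 → ℂ) (n : ℕ) :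
    ContDiff ℂ n (rootFamily hQ t v) :=
  (differentiable_rootFamily hQ t v).contDiff

theorem rootFamily_sub_sysOp (hQ : IsBVPotential p q) (t : ℂ) (v : Fin 2 → ℂ) (lam : ℂ) :
    rootFamily hQ t v lam - sysOp hQ lam (rootFamily hQ t v lam) =
      constCLM (rootFamily hQ t v lam 0) := by
  rw [rootFamily, sol_apply_zero]
  exact solOp_sub_sysOp_solOp hQ lam _

theorem taylorChain_rootFamily_sub_sysOp (hQ : IsBVPotential p q) (t : ℂ) (v : Fin 2 → ℂ) (μ : ℂ)
    (k : ℕ) :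
    taylorChain (rootFamily hQ t v) μ (k + 1) -
        sysOp hQ μ (taylorChain (rootFamily hQ t v) μ (k + 1)) =
      constCLM (taylorChain (rootFamily hQ t v) μ (k + 1) 0) +
        rotOp (taylorChain (rootFamily hQ t v) μ k) := by
  set S := constCLM.comp (BoundedContinuousFunction.evalCLM ℂ (0 : ℝ)) +
    hQ.isVolterraCoeff.volterra Real.pi_pos.le
  have hS : ∀ lam y, S y + lam • rotOp y = constCLM (y 0) + sysOp hQ lam y := fun lam y ↦ by
    rw [sysOp_eq_add_smul_rotOp]
    exact add_assoc _ _ _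
  rw [sub_eq_iff_eq_add, add_right_comm, ← hS]
  refine taylorChain_succ_eq S rotOp (contDiff_rootFamily hQ t v) (fun lam ↦ ?_) μ k
  rw [hS, ← rootFamily_sub_sysOp, sub_add_cancel]

theorem boundaryCLM_taylorChain_rootFamily (hQ : IsBVPotential p q) (t : ℂ) (v : Fin 2 → ℂ)
    (μ : ℂ) (k : ℕ) :
    boundaryCLM t (taylorChain (rootFamily hQ t v) μ (k + 1)) =
      (k.factorial : ℂ)⁻¹ • iteratedDeriv k (charFun hQ t) μ •
        Complex.exp (Complex.I * Real.pi * t) • v := by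
  rw [clm_taylorChain_succ _ _ (contDiff_rootFamily hQ t v k).contDiffAt]
  simp only [boundaryCLM_rootFamily]
  rw [iteratedDeriv_smul_const (differentiable_charFun hQ t).contDiff.contDiffAt]

theorem toL2_taylorChain_rootFamily_notMem_shiftedGraph (hQ : IsBVPotential p q) {t μ : ℂ}
    {v : Fin 2 → ℂ} (hv : (charMatrix hQ t μ).adjugate.mulVec v ≠ 0) (hμ : charFun hQ t μ = 0)
    {n : ℕ} (hn : iteratedDeriv n (charFun hQ t) μ ≠ 0) (f : L2) :
    (f, toL2 (taylorChain (rootFamily hQ t v) μ n)) ∉ shiftedGraph (operator p q t) μ := by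
  intro hf
  obtain ⟨y, -, hy, hb⟩ := exists_of_mem_shiftedGraph hQ hf
  set w := taylorChain (rootFamily hQ t v) μ (n + 1) - y
  have hw : w = sol hQ μ (w 0) := by
    refine eq_sol_of_sub_sysOp_eq hQ ?_
    rw [map_sub, sub_sub_sub_comm, taylorChain_rootFamily_sub_sysOp, hy,
      add_sub_add_right_eq_sub, ← map_sub]
    rfl
  have hwb := boundaryCLM_sol hQ t μ (w 0)
  rw [← hw, map_sub, hb, sub_zero, boundaryCLM_taylorChain_rootFamily] at hwb
  have hadj := congrArg (charMatrix hQ t μ).adjugate.mulVec hwb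
  rw [Matrix.mulVec_mulVec, Matrix.adjugate_mul, det_charMatrix, hμ, mul_zero, zero_smul,
    Matrix.zero_mulVec, Matrix.mulVec_smul, Matrix.mulVec_smul, Matrix.mulVec_smul] at hadj
  have hfact : (n.factorial : ℂ)⁻¹ ≠ 0 := inv_ne_zero (Nat.cast_ne_zero.2 n.factorial_ne_zero)
  exact smul_ne_zero hfact (smul_ne_zero hn (smul_ne_zero (Complex.exp_ne_zero _) hv)) hadj

theorem isMaximalJordanChain_taylorChain_rootFamily (hQ : IsBVPotential p q) {t μ : ℂ}
    {v : Fin 2 → ℂ} (hv : (charMatrix hQ t μ).adjugate.mulVec v ≠ 0) (hμ : charFun hQ t μ = 0)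
    {n : ℕ} (hn : analyticOrderAt (charFun hQ t) μ = n) :
    IsMaximalJordanChain (operator p q t) μ n
      fun k ↦ toL2 (taylorChain (rootFamily hQ t v) μ k) := by
  obtain ⟨hlt, hne⟩ := (analyticOrderAt_eq_nat_iff_iteratedDeriv_eq_zero
    ((differentiable_charFun hQ t).analyticAt μ)).1 hn
  have hdet : (charMatrix hQ t μ).det = 0 := by rw [det_charMatrix, hμ, mul_zero]
  have hone : taylorChain (rootFamily hQ t v) μ 1 =
      sol hQ μ ((charMatrix hQ t μ).adjugate.mulVec v) := taylorChain_one _ μ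
  have hker : (charMatrix hQ t μ).mulVec ((charMatrix hQ t μ).adjugate.mulVec v) = 0 := by
    rw [Matrix.mulVec_mulVec, Matrix.mul_adjugate, hdet, zero_smul, Matrix.zero_mulVec]
  exact {
    zero := map_zero toL2
    one_ne_zero := toL2_ne_zero (by rwa [hone, sol_apply_zero])
    mem_shiftedGraph := fun k hk ↦ by
      refine toL2_mem_shiftedGraph hQ (taylorChain_rootFamily_sub_sysOp hQ t v μ k) ?_
      rw [boundaryCLM_taylorChain_rootFamily, hlt k hk, zero_smul, smul_zero]
    exists_eq_smul := fun f hf ↦ by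
      obtain ⟨c, rfl, hc⟩ := exists_eq_toL2_sol hQ hf
      have hA : charMatrix hQ t μ ≠ 0 := fun hA ↦
        hv (by rw [hA, Matrix.adjugate_zero, Matrix.zero_mulVec])
      obtain ⟨a, rfl⟩ := exists_eq_smul_of_mulVec_eq_zero hA hv hker hc
      exact ⟨a, by rw [hone, map_smul, map_smul]⟩
    notMem_shiftedGraph := toL2_taylorChain_rootFamily_notMem_shiftedGraph hQ hv hμ hne }

end Characteristic

section Spectrum

variable {p q : ℝ → ℂ} {t : ℂ}

theorem exists_isMaximalJordanChain (hQ : IsBVPotential p q) (ht : ∀ m : ℤ, t ≠ m)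
    (hχ : charFun hQ t ≠ 0) {μ : ℂ} (hμ : charFun hQ t μ = 0) :
    ∃ (n : ℕ) (d : ℕ → L2), analyticOrderAt (charFun hQ t) μ = n ∧
      IsMaximalJordanChain (operator p q t) μ n d := by
  have hadj := adjugate_fin_two_ne_zero (charMatrix_ne_zero hQ ht μ)
  obtain ⟨v, hv⟩ : ∃ v, (charMatrix hQ t μ).adjugate.mulVec v ≠ 0 := by
    by_contra! h
    exact hadj (Matrix.ext_iff_mulVec.2 fun v ↦ by rw [h, Matrix.zero_mulVec])
  have hn := (Nat.cast_analyticOrderNatAt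
    (analyticOrderAt_ne_top_of_differentiable (differentiable_charFun hQ t) hχ μ)).symm
  exact ⟨_, _, hn, isMaximalJordanChain_taylorChain_rootFamily hQ hv hμ hn⟩

theorem isEigenvalue_operator_iff (hQ : IsBVPotential p q) (ht : ∀ m : ℤ, t ≠ m)
    (hχ : charFun hQ t ≠ 0) {μ : ℂ} :
    IsEigenvalue (operator p q t) μ ↔ charFun hQ t μ = 0 := by
  refine ⟨charFun_eq_zero_of_isEigenvalue hQ, fun hμ ↦ ?_⟩
  obtain ⟨n, d, -, hd⟩ := exists_isMaximalJordanChain hQ ht hχ hμ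
  exact hd.isEigenvalue

theorem multiplicity_operator (hQ : IsBVPotential p q) (ht : ∀ m : ℤ, t ≠ m)
    (hχ : charFun hQ t ≠ 0) (μ : ℂ) :
    multiplicity (operator p q t) μ = analyticOrderAt (charFun hQ t) μ := by
  by_cases hμ : charFun hQ t μ = 0
  · obtain ⟨n, d, hn, hd⟩ := exists_isMaximalJordanChain hQ ht hχ hμ
    rw [hd.multiplicity_eq, hn]
  · rw [multiplicity_eq_zero (mt (charFun_eq_zero_of_isEigenvalue hQ) hμ),
      ((differentiable_charFun hQ t).analyticAt μ).analyticOrderAt_eq_zero.2 hμ]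

theorem exists_norm_charFun_sub_freeChar_le (hQ : IsBVPotential p q) :
    ∃ C, 0 < C ∧ ∀ t lam : ℂ, C ≤ ‖lam‖ →
      ‖charFun hQ t lam - freeChar t lam‖ ≤ C / ‖lam‖ * Real.exp (Real.pi * |lam.im|) := by
  obtain ⟨C, hC, h⟩ := exists_norm_disc_sub_le hQ
  refine ⟨C, hC, fun t lam hlam ↦ ?_⟩
  rw [charFun, freeChar, sub_sub_sub_cancel_left, norm_sub_rev]
  exact h lam hlam

end Spectrum

end Dirac

theorem encard_setOf_sum_eq {α β γ : Type*} (z : α ⊕ β → γ) (w : γ) :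
    {i | z i = w}.encard = {a | z (.inl a) = w}.encard + {b | z (.inr b) = w}.encard := by
  have hunion :
      {i | z i = w} = Sum.inl '' {a | z (.inl a) = w} ∪ Sum.inr '' {b | z (.inr b) = w} := by
    ext (a | b) <;> simp
  rw [hunion, Set.encard_union_eq (Set.disjoint_image_inl_image_inr),
    Sum.inl_injective.encard_image, Sum.inr_injective.encard_image]

theorem theorem1_general {p q : ℝ → ℂ} (hpv : BoundedVariationOn p (Set.Icc 0 Real.pi))
    (hqv : BoundedVariationOn q (Set.Icc 0 Real.pi)) {K : Set ℂ} (hK : Bornology.IsBounded K)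
    {δ : ℝ} (hδ : 0 < δ) (hKδ : ∀ t ∈ K, ∀ m : ℤ, δ ≤ ‖t - m‖) :
    ∃ lam₁ lam₂ : ℤ → ℂ → ℂ,
      (∀ t ∈ K,
        (∀ μ : ℂ, Dirac.IsEigenvalue (Dirac.operator p q t) μ ↔
          ∃ n : ℤ, lam₁ n t = μ ∨ lam₂ n t = μ) ∧
        (∀ μ : ℂ, Dirac.multiplicity (Dirac.operator p q t) μ =
          {n : ℤ | lam₁ n t = μ}.encard + {n : ℤ | lam₂ n t = μ}.encard)) ∧
      ∃ (M : ℝ) (N : ℕ), ∀ t ∈ K, ∀ n : ℤ, (N : ℤ) < |n| →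
        ‖lam₁ n t - (2 * n + t)‖ ≤ M / |(n : ℝ)| ∧
        ‖lam₂ n t - (2 * n - t)‖ ≤ M / |(n : ℝ)| := by
  have hQ : Dirac.IsBVPotential p q := ⟨hpv, hqv⟩
  obtain ⟨B, hB⟩ := hK.exists_norm_le
  obtain ⟨C, hC, hfree⟩ := Dirac.exists_norm_charFun_sub_freeChar_le hQ
  obtain ⟨M, N, h⟩ := Dirac.exists_enumeratesZeros_norm_sub_freeRoot_le (B := B) hδ hC.le C
  choose! z hz hzM using fun t (ht : t ∈ K) ↦ h t (hB t ht) (hKδ t ht) (Dirac.charFun hQ t)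
    (Dirac.differentiable_charFun hQ t) (hfree t)
  refine ⟨fun n t ↦ z t (.inl n), fun n t ↦ z t (.inr n), fun t ht ↦ ?_,
    M, N, fun t ht n hn ↦ ⟨hzM t ht (.inl n) hn, hzM t ht (.inr n) hn⟩⟩
  have htm : ∀ m : ℤ, t ≠ m := fun m ↦ sub_ne_zero.1 (norm_pos_iff.1 (hδ.trans_le (hKδ t ht m)))
  refine ⟨fun μ ↦ ?_, fun μ ↦ ?_⟩
  · rw [Dirac.isEigenvalue_operator_iff hQ htm (hz t ht).ne_zero, (hz t ht).eq_zero_iff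
      (Dirac.differentiable_charFun hQ t), Sum.exists, exists_or]
  · rw [Dirac.multiplicity_operator hQ htm (hz t ht).ne_zero, hz t ht μ, encard_setOf_sum_eq]

theorem theorem1 (p q : ℝ → ℂ)
    (hp : Function.Periodic p Real.pi) (hq : Function.Periodic q Real.pi)
    (hpv : BoundedVariationOn p (Set.Icc 0 Real.pi))
    (hqv : BoundedVariationOn q (Set.Icc 0 Real.pi))
    (h : ℝ) (hh : h ∈ Set.Ioo (0 : ℝ) (1 / 10)) :
    ∃ lam₁ lam₂ : ℤ → ℂ → ℂ,
      (∀ t ∈ Dirac.region h,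
        (∀ μ : ℂ, Dirac.IsEigenvalue (Dirac.operator p q t) μ ↔
          ∃ n : ℤ, lam₁ n t = μ ∨ lam₂ n t = μ) ∧
        (∀ μ : ℂ, Dirac.multiplicity (Dirac.operator p q t) μ =
          {n : ℤ | lam₁ n t = μ}.encard + {n : ℤ | lam₂ n t = μ}.encard)) ∧
      ∃ (M : ℝ) (N : ℕ), ∀ t ∈ Dirac.region h, ∀ n : ℤ, (N : ℤ) < |n| →
        ‖lam₁ n t - (2 * n + t)‖ ≤ M / |(n : ℝ)| ∧
        ‖lam₂ n t - (2 * n - t)‖ ≤ M / |(n : ℝ)| :=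
  theorem1_general hpv hqv (Dirac.isBounded_region h) hh.1
    fun _ ht ↦ Dirac.le_norm_sub_int_of_mem_region hh ht
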